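/- Let $\delta>0$ and let $S\subseteq\delta\mathbb Z^n\subset\mathbb R^n$. Let $\tilde w_1,\dots,\tilde w_N:S\to S$ be maps and $p_1,\dots,p_N:S\to(0,1]$ functions with $\sum_{i=1}^N p_i(x)=1$ for all $x\in S$ (a discrete iterated function system with place-dependent probabilities, DIFS). The associated Markov chain on $S$ has transition probabilities $P_{xy}=\sum_{i=1}^N p_i(x)\mathbf 1_{\{y\}}(\tilde w_i(x))$. A state $x$ is recurrent if the chain started at $x$ almost surely returns to $x$, positive recurrent if it is recurrent and its expected return time is finite, and transient if it is not recurrent; $\mathcal T$ is the set of transient states. A (positive) recurrent class is a closed communication class $A\subseteq S$ all of whose states are (positive) recurrent. The random iteration algorithm (RIA) started at $x_0\in S$ generates the random orbit $X_0=x_0$, $X_{k}=\tilde w_{I_{k}}(X_{k-1})$ for $k\ge1$, where, given $X_0,\dots,X_{k-1}$, the index $I_k$ is drawn from the distribution $(p_1(X_{k-1}),\dots,p_N(X_{k-1}))$. Suppose that for every initial state $x\in S$ the chain almost surely leaves the transient states, i.e. $\Pr(\exists i:\ X_i\notin\mathcal T\mid X_0=x)=1$; or suppose that $S$ is finite. Let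 $(X_i)_{i\ge0}$ be an RIA orbit started at any $x_0\in S$. Then: 1. Almost surely there are a recurrent class $A$ and an $m\in\mathbb N$ (both depending on the orbit) such that $\{X_i: i\ge m\}=A$; and if this class $A$ is positive recurrent, then $\frac1M\sum_{i=0}^{M-1}\delta_{X_i}$ converges weakly, as $M\to\infty$, to the stationary distribution on $A$. 2. Every positive recurrent class $A$ carries a unique stationary distribution $\pi_A$ of the chain (a probability measure on $S$ with $\pi_A P=\pi_A$ and $\pi_A(A)=1$), and for every $j\in\mathbb N$: if $\Pr(X_j\in A)=1$, then almost surely $\frac1M\sum_{i=0}^{M-1}\mathbf 1_{\{y\}}(X_i)\to\pi_A\{y\}$ for all $y\in S$; and if $\Pr(X_j\in A)>0$, then $$\Pr\Big(\lim_{M\to\infty}\tfrac1M\sum_{i=0}^{M-1}\delta_{X_i}=\pi_A\ \Big|\ X_j\in A\Big)=1$$ in the sense of weak convergence, and for every $y\in S$ $$\Pr\Big(\lim_{M\to\infty}\tfrac1M\sum_{i=0}^{M-1}\mathbf 1_{\{y\}}(X_i)=\pi_A\{y\}\ \Big|\ X_j\in A\Big)=1 .$$ 3. If $S$ is finite, then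 the chain almost surely leaves the transient states from every initial state, and every recurrent class is positive recurrent. -/

import Mathlib

open MeasureTheory ProbabilityTheory Filter Topology

noncomputable section

/-! Countable Markov chains, given by their one-step transition kernel. -/

namespace MarkovChain

variable {E : Type*} [MeasurableSpace E] (P : Kernel E E) [IsMarkovKernel P]

/-- The law on `ℕ → E` of the time-homogeneous Markov chain with transition kernel `P`
started at `x`: given the states at times `0, …, k`, the state at time `k + 1` has law
`P` (state at time `k`). -/
def law (x : E) : Measure (ℕ → E) :=
  Kernel.traj (X := fun _ => E)
    (fun k => P.comap (fun h : (i : Finset.Iic k) → E => h ⟨k, Finset.mem_Iic.2 le_rfl⟩)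
      (measurable_pi_apply _))
    0 (fun _ => x)

/-- `y` is accessible from `x`: for some `k ≥ 1` the chain started at `x` is at `y` at time `k`
with positive probability. -/
def Accessible (x y : E) : Prop :=
  ∃ k : ℕ, 1 ≤ k ∧ 0 < law P x {ω | ω k = y}

/-- `x` and `y` are accessible from each other. -/
def Communicate (x y : E) : Prop :=
  Accessible P x y ∧ Accessible P y x

/-- A (nonempty) maximal set of states any two of which communicate. -/
def IsCommunicationClass (C : Set E) : Prop :=
  C.Nonempty ∧ Maximal (fun B : Set E => ∀ x ∈ B, ∀ y ∈ B, Communicate P x y) C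

/-- Only states of `C` are accessible from `C`. -/
def IsClosedClass (C : Set E) : Prop :=
  ∀ x ∈ C, ∀ y, Accessible P x y → y ∈ C

/-- The chain started at `x` returns to `x` almost surely. -/
def IsRecurrent (x : E) : Prop :=
  ∀ᵐ ω ∂(law P x), ∃ k : ℕ, 1 ≤ k ∧ ω k = x

/-- The first time `k ≥ 1` at which the trajectory `ω` is at `x` (`∞` if there is none). -/
def returnTime (x : E) (ω : ℕ → E) : ENNReal :=
  ⨅ (k : ℕ) (_ : 1 ≤ k ∧ ω k = x), (k : ENNReal)

/-- A recurrent state whose expected return time is finite. -/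
def IsPositiveRecurrent (x : E) : Prop :=
  IsRecurrent P x ∧ ∫⁻ ω, returnTime x ω ∂(law P x) < ⊤

/-- The set of transient (i.e. not recurrent) states. -/
def transientSet : Set E := {x | ¬ IsRecurrent P x}

/-- A recurrent communication class: a closed communication class of recurrent states. -/
def IsRecurrentClass (A : Set E) : Prop :=
  IsCommunicationClass P A ∧ IsClosedClass P A ∧ ∀ x ∈ A, IsRecurrent P x

/-- A positive recurrent communication class. -/
def IsPositiveRecurrentClass (A : Set E) : Prop :=
  IsRecurrentClass P A ∧ ∀ x ∈ A, IsPositiveRecurrent P x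

/-- For every initial state the chain almost surely visits a non-transient state. -/
def LeavesTransient : Prop :=
  ∀ x : E, ∀ᵐ ω ∂(law P x), ∃ i : ℕ, ω i ∉ transientSet P

/-- `π` is a stationary distribution of the chain on `A`: a probability measure with
`π P = π` and `π A = 1`. -/
def IsStationaryOn (A : Set E) (π : ProbabilityMeasure E) : Prop :=
  P.Invariant (π : Measure E) ∧ (π : Measure E) A = 1

end MarkovChain

/-- The empirical measure `(1/M) ∑_{i < M} δ_{x i}` of a sequence `x` of points. -/
def empiricalMeasure {E : Type*} [MeasurableSpace E] (x : ℕ → E) (M : ℕ) : FiniteMeasure E :=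
  (M : NNReal)⁻¹ • ∑ i ∈ Finset.range M, (diracProba (x i)).toFiniteMeasure

/-- The `δ`-discretization `{δ m : m ∈ ℤⁿ}` of `ℝⁿ`, the set of centres of the `δ`-cubes. -/
def discretization (n : ℕ) (δ : ℝ) : Set (Fin n → ℝ) :=
  Set.range fun (m : Fin n → ℤ) (j : Fin n) => δ * (m j : ℝ)

/-- A discrete iterated function system with place-dependent probabilities. The state space `S`
carries the topology and Borel sets of `ℝⁿ`, which are the same for every norm on `ℝⁿ`. -/
structure DIFS (n N : ℕ) (δ : ℝ) where
  /-- the state space -/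
  S : Set (Fin n → ℝ)
  subset : S ⊆ discretization n δ
  /-- the maps -/
  w : Fin N → S → S
  /-- the probability weights -/
  p : Fin N → S → ℝ
  p_mem : ∀ i x, p i x ∈ Set.Ioc (0 : ℝ) 1
  p_sum : ∀ x, ∑ i, p i x = 1

namespace DIFS

variable {n N : ℕ} {δ : ℝ} (D : DIFS n N δ)

instance countable_S : Countable D.S :=
  ((Set.countable_range _).mono D.subset).to_subtype

/-- The transition kernel of the associated Markov chain: from `x` the chain moves to `y` with
probability `∑ i, p i x * 1_{y} (w i x)`. -/
def kernel : Kernel D.S D.S :=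
  Kernel.ofFunOfCountable fun x => ∑ i, ENNReal.ofReal (D.p i x) • Measure.dirac (D.w i x)

instance isMarkovKernel_kernel : IsMarkovKernel D.kernel := by
  refine ⟨fun x => ⟨?_⟩⟩
  change (∑ i, ENNReal.ofReal (D.p i x) • Measure.dirac (D.w i x)) Set.univ = 1
  simp only [Measure.finsetSum_apply, Measure.smul_apply, measure_univ, smul_eq_mul, mul_one]
  rw [← ENNReal.ofReal_sum_of_nonneg fun i _ => (D.p_mem i x).1.le, D.p_sum, ENNReal.ofReal_one]

/-- `X` is the random orbit generated from `x₀` by the random iteration algorithm with the random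
map indices `I 1, I 2, …` (`I 0` is not used): `X 0 = x₀`, `X (k + 1) = w_{I (k + 1)} (X k)`, and
given `X 0, …, X k`, the index `I (k + 1)` is drawn from the distribution `(p i (X k))_i`. -/
structure IsRIA {Ω : Type*} [MeasurableSpace Ω] (μ : Measure Ω) (x₀ : D.S)
    (I : ℕ → Ω → Fin N) (X : ℕ → Ω → D.S) : Prop where
  measurable_index : ∀ k, Measurable (I (k + 1))
  start : ∀ ω, X 0 ω = x₀
  step : ∀ k ω, X (k + 1) ω = D.w (I (k + 1) ω) (X k ω)
  draw : ∀ (k : ℕ) (y : ℕ → D.S) (i : Fin N),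
    μ {ω | (∀ j ≤ k, X j ω = y j) ∧ I (k + 1) ω = i} =
      ENNReal.ofReal (D.p i (y k)) * μ {ω | ∀ j ≤ k, X j ω = y j}

end DIFS

end

/-!
The orbit of the random iteration algorithm is a realization of the chain: its law is determined by
the probabilities of finite paths, which satisfy the same recursion for both
(`DIFS.IsRIA.map_orbit_eq_law`). It therefore suffices to study a Markov chain on a countable space.

The path is cut at the returns to a recurrent state `x`. By the strong Markov property
(`law_inter_nextExcursion_preimage`) the path seen from the first return on has again the law
started at `x` and is independent of the excursion before it. If `y` is accessible from `x`, the
excursions hence visit `y` infinitely often almost surely (`IsRecurrent.ae_frequently_of_accessible`).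
It follows that the states accessible from `x` form a recurrent class and that the path visits
exactly these states. A chain that leaves the transient states reaches such an `x`, and its tail is
then a recurrent class (`LeavesTransient.ae_exists_isRecurrentClass`).

If `x` is positive recurrent, the strong law of large numbers for the excursion lengths and for the
numbers of visits to `y` during the excursions gives visit frequencies that do not depend on the path
(`IsPositiveRecurrent.exists_hasVisitFrequencies`), nor on the starting point within the class. For
any stationary distribution `π` on the class, the expected visit frequency of `y` under the chain
started from `π` is `π {y}` at all times, so by dominated convergence `π {y}` is the almost sure limit
(`IsStationaryOn.real_singleton_eq`); this gives uniqueness. Existence comes from the expected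
numbers of visits during an excursion (`IsRecurrent.invariant_excursionMeasure`). On a countable
space, convergence of all visit frequencies to the masses of a probability measure is weak
convergence (`HasVisitFrequencies.tendsto_empiricalMeasure`).

On a finite space some state is visited infinitely often, which a transient state is not
(`ae_not_frequently_of_not_isRecurrent`), and invariance bounds each mass of the excursion measure,
whose total mass is the expected return time
(`IsRecurrentClass.isPositiveRecurrentClass_of_finite`).
-/

/-! ### Laws on path space and the Markov property -/

namespace MarkovChain

/-- The set of paths that follow `y` up to time `k`. -/
def pathCylinder {E : Type*} (y : ℕ → E) (k : ℕ) : Set (ℕ → E) :=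
  {ω | ∀ j ≤ k, ω j = y j}

/-- The path `ω` seen from time `k` on. -/
def shift {E : Type*} (k : ℕ) (ω : ℕ → E) : ℕ → E := fun i => ω (k + i)

section Basic

variable {E : Type*} [MeasurableSpace E]

theorem measurable_shift (k : ℕ) : Measurable (shift k : (ℕ → E) → ℕ → E) :=
  measurable_pi_lambda _ fun _ => measurable_pi_apply _

theorem pathCylinder_eq_preimage {E : Type*} (y : ℕ → E) (k : ℕ) :
    pathCylinder y k = Preorder.frestrictLe (π := fun _ => E) k ⁻¹'
      {Preorder.frestrictLe (π := fun _ => E) k y} := by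
  ext ω
  simp [pathCylinder, funext_iff]

theorem measurableSet_coord_eq [MeasurableSingletonClass E] (k : ℕ) (y : E) :
    MeasurableSet {ω : ℕ → E | ω k = y} :=
  (measurable_pi_apply k (measurableSet_singleton y) :
    MeasurableSet ((fun ω : ℕ → E => ω k) ⁻¹' {y}))

theorem exists_frestrictLe_eq {E : Type*} (k : ℕ) (h : (i : Finset.Iic k) → E) :
    ∃ y : ℕ → E, Preorder.frestrictLe (π := fun _ => E) k y = h := by
  refine ⟨fun i => if hi : i ≤ k then h ⟨i, Finset.mem_Iic.2 hi⟩ else h ⟨0, by simp⟩, ?_⟩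
  ext i
  have := Finset.mem_Iic.1 i.2
  simp [this]

variable (P : Kernel E E) [IsMarkovKernel P]

instance isProbabilityMeasure_law (x : E) : IsProbabilityMeasure (law P x) := by
  unfold law
  infer_instance

variable [MeasurableSingletonClass E]

theorem measurableSet_pathCylinder (y : ℕ → E) (k : ℕ) : MeasurableSet (pathCylinder y k) := by
  rw [pathCylinder_eq_preimage]
  exact Preorder.measurable_frestrictLe k (measurableSet_singleton _)

theorem law_pathCylinder_zero (x : E) (y : ℕ → E) :
    law P x (pathCylinder y 0) = ({y 0} : Set E).indicator 1 x := by
  rw [pathCylinder_eq_preimage, ← Measure.map_apply (Preorder.measurable_frestrictLe 0)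
    (measurableSet_singleton _), law, Kernel.traj_map_frestrictLe_apply,
    Kernel.partialTraj_self, Kernel.id_apply, Measure.dirac_apply' _ (measurableSet_singleton _)]
  by_cases h : x = y 0
  · rw [Set.indicator_of_mem, Set.indicator_of_mem] <;> simp [h, funext_iff]
  · rw [Set.indicator_of_notMem, Set.indicator_of_notMem] <;> simp [h, funext_iff]

theorem law_coord_zero (x : E) : ∀ᵐ ω ∂(law P x), ω 0 = x := by
  have h : pathCylinder (fun _ => x) 0 = {ω : ℕ → E | ω 0 = x} := by
    ext ω
    simp [pathCylinder]
  have h' := law_pathCylinder_zero P x (fun _ => x)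
  rw [h] at h'
  rw [ae_iff, ← Set.compl_ofPred, prob_compl_eq_zero_iff (measurableSet_coord_eq 0 x), h']
  simp

theorem law_pathCylinder_succ (x : E) (y : ℕ → E) (k : ℕ) :
    law P x (pathCylinder y (k + 1)) = law P x (pathCylinder y k) * P (y k) {y (k + 1)} := by
  set κ : (k : ℕ) → Kernel ((i : Finset.Iic k) → E) E :=
    fun k => P.comap (fun h : (i : Finset.Iic k) → E => h ⟨k, Finset.mem_Iic.2 le_rfl⟩)
      (measurable_pi_apply _) with hκ
  have h1 := Kernel.partialTraj_compProd_eq_map_traj (X := fun _ => E) (κ := κ)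
    (Nat.zero_le k) (x₀ := fun _ => x)
  have h2 := congrArg (fun m => m ({Preorder.frestrictLe (π := fun _ => E) k y} ×ˢ {y (k + 1)})) h1
  beta_reduce at h2
  rw [Measure.compProd_apply_prod (measurableSet_singleton _) (measurableSet_singleton _),
    Measure.map_apply (by fun_prop)
      ((measurableSet_singleton _).prod (measurableSet_singleton _)),
    lintegral_singleton, ← Kernel.traj_map_frestrictLe_apply,
    Measure.map_apply (by fun_prop) (measurableSet_singleton _),
    ← pathCylinder_eq_preimage] at h2
  have h3 : (fun ω : ℕ → E => (Preorder.frestrictLe (π := fun _ => E) k ω, ω (k + 1))) ⁻¹'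
      ({Preorder.frestrictLe (π := fun _ => E) k y} ×ˢ {y (k + 1)}) = pathCylinder y (k + 1) := by
    ext ω
    simp only [pathCylinder, Set.mem_preimage, Set.mem_prod, Set.mem_singleton_iff, funext_iff,
      Preorder.frestrictLe_apply, Subtype.forall, Finset.mem_Iic, Set.mem_ofPred_eq]
    refine ⟨fun h j hj => ?_, fun h => ⟨fun j hj => h j (by lia), h _ le_rfl⟩⟩
    rcases Nat.le_succ_iff.1 hj with hj | rfl
    exacts [h.1 j hj, h.2]
  rw [h3] at h2
  rw [law, ← h2, mul_comm]
  rfl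

variable [Countable E]

/-- Over a countable state space, a finite measure on paths is determined by the probabilities
of finite paths. -/
theorem measure_ext_of_pathCylinder {μ ν : Measure (ℕ → E)} [IsFiniteMeasure μ]
    [IsFiniteMeasure ν] (h : ∀ y k, μ (pathCylinder y k) = ν (pathCylinder y k)) : μ = ν := by
  have hp : IsProjectiveMeasureFamily (α := fun _ : ℕ => E)
      fun I : Finset ℕ => ν.map (I.restrict (π := fun _ => E)) := by
    intro I J hJI
    rw [Measure.map_map (by fun_prop) (by fun_prop)]
    rfl
  have hν : IsProjectiveLimit ν fun I : Finset ℕ => ν.map (I.restrict (π := fun _ => E)) :=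
    fun _ => rfl
  refine IsProjectiveLimit.unique ((isProjectiveLimit_nat_iff hp μ).2 fun k => ?_) hν
  refine Measure.ext_of_singleton fun a => ?_
  obtain ⟨y, rfl⟩ := exists_frestrictLe_eq k a
  have := h y k
  rw [pathCylinder_eq_preimage] at this
  rw [Measure.map_apply (Preorder.measurable_frestrictLe k) (measurableSet_singleton _), this,
    Measure.map_apply (by fun_prop) (measurableSet_singleton _)]
  rfl

/-- The law of the chain is characterized by its starting point and by the one-step transition
probabilities along finite paths. -/
theorem eq_law_of_pathCylinder_succ {x : E} {Q : Measure (ℕ → E)} [IsProbabilityMeasure Q]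
    (h0 : ∀ᵐ ω ∂(Q), ω 0 = x)
    (hs : ∀ y k, Q (pathCylinder y (k + 1)) = Q (pathCylinder y k) * P (y k) {y (k + 1)}) :
    Q = law P x := by
  refine measure_ext_of_pathCylinder fun y k => ?_
  induction k with
  | zero =>
    have h : ∀ R : Measure (ℕ → E), IsProbabilityMeasure R → (∀ᵐ ω ∂(R), ω 0 = x) →
        R (pathCylinder y 0) = R {ω | x = y 0} := fun R _ hR => by
      refine measure_congr (eventuallyEq_set.2 ?_)
      filter_upwards [hR] with ω hω
      simp [pathCylinder, hω]
    rw [h Q inferInstance h0, h (law P x) inferInstance (law_coord_zero P x)]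
    by_cases hx : x = y 0 <;> simp [hx]
  | succ k ih => rw [hs, law_pathCylinder_succ, ih]

/-- The Markov property on a single finite path. -/
theorem law_restrict_pathCylinder_map_shift (x : E) (y : ℕ → E) (k : ℕ) :
    ((law P x).restrict (pathCylinder y k)).map (shift k) =
      law P x (pathCylinder y k) • law P (y k) := by
  have : IsFiniteMeasure (law P x (pathCylinder y k) • law P (y k)) :=
    Measure.smul_finite _ (measure_ne_top _ _)
  refine measure_ext_of_pathCylinder fun z m => ?_
  rw [Measure.map_apply (measurable_shift k) (measurableSet_pathCylinder z m),
    Measure.restrict_apply (measurable_shift k (measurableSet_pathCylinder z m)),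
    Measure.smul_apply, smul_eq_mul]
  by_cases hz : z 0 = y k
  · -- the path following `y` up to time `k` and then `z`
    let c : ℕ → E := fun j => if j ≤ k then y j else z (j - k)
    have hc : ∀ j, c (k + j) = z j := by
      intro j
      rcases Nat.eq_zero_or_pos j with rfl | hj
      · simp [c, hz]
      · simp [c, hj.ne']
    have hset : ∀ m, shift k ⁻¹' pathCylinder z m ∩ pathCylinder y k = pathCylinder c (k + m) := by
      intro m
      ext ω
      simp only [pathCylinder, shift, Set.mem_inter_iff, Set.mem_preimage, Set.mem_ofPred_eq]
      constructor
      · rintro ⟨h1, h2⟩ j hj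
        by_cases hjk : j ≤ k
        · simp [c, hjk, h2 j hjk]
        · obtain ⟨i, rfl⟩ := Nat.exists_eq_add_of_le (not_le.1 hjk).le
          rw [hc, h1 i (by lia)]
      · intro h
        refine ⟨fun j hj => by rw [h _ (by lia), hc], fun j hj => ?_⟩
        rw [h j (by lia)]
        simp [c, hj]
    rw [hset]
    induction m with
    | zero =>
      rw [← hset, law_pathCylinder_zero, hz]
      simp only [Set.mem_singleton_iff, Set.indicator_of_mem, Pi.one_apply, mul_one]
      congr 1
      refine Set.inter_eq_self_of_subset_right fun ω hω => ?_
      have := hω k le_rfl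
      simp [pathCylinder, shift, this, hz]
    | succ m ih =>
      rw [← add_assoc, law_pathCylinder_succ, ih, law_pathCylinder_succ, hc, add_assoc, hc,
        mul_assoc]
  · have h1 : shift k ⁻¹' pathCylinder z m ∩ pathCylinder y k = ∅ := by
      ext ω
      simp only [pathCylinder, shift, Set.mem_inter_iff, Set.mem_preimage, Set.mem_ofPred_eq,
        Set.mem_empty_iff_false, iff_false, not_and]
      intro h1 h2
      exact hz ((h1 0 (Nat.zero_le _)).symm.trans (h2 k le_rfl))
    have h2 : law P (y k) (pathCylinder z m) = 0 := by
      refine measure_mono_null (fun ω hω => ?_) (law_coord_zero P (y k))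
      have := hω 0 (Nat.zero_le _)
      simpa [this] using hz
    rw [h1, h2]
    simp

theorem exists_eq_frestrictLe_preimage {E : Type*} {B : Set (ℕ → E)} {k : ℕ}
    (hB : DependsOn (fun ω => ω ∈ B) (Set.Iic k)) :
    ∃ H, B = Preorder.frestrictLe (π := fun _ => E) k ⁻¹' H := by
  refine ⟨Preorder.frestrictLe (π := fun _ => E) k '' B, Set.Subset.antisymm
    (Set.subset_preimage_image _ _) ?_⟩
  rintro ω ⟨ω', hω', h⟩
  refine (hB (x := ω') (y := ω) fun i hi => ?_).mp hω'
  exact congrFun h ⟨i, Finset.mem_Iic.2 hi⟩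

theorem measurableSet_of_dependsOn {B : Set (ℕ → E)} {k : ℕ}
    (hB : DependsOn (fun ω => ω ∈ B) (Set.Iic k)) : MeasurableSet B := by
  obtain ⟨H, rfl⟩ := exists_eq_frestrictLe_preimage hB
  exact Preorder.measurable_frestrictLe k H.to_countable.measurableSet

/-- The Markov property: given the past up to time `k` and the state `y` at time `k`, the future
is a chain started at `y`. -/
theorem law_inter_shift_preimage (x y : E) {k : ℕ} {B : Set (ℕ → E)}
    (hB : DependsOn (fun ω => ω ∈ B) (Set.Iic k)) (hy : ∀ ω ∈ B, ω k = y)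
    {C : Set (ℕ → E)} (hC : MeasurableSet C) :
    law P x (B ∩ shift k ⁻¹' C) = law P x B * law P y C := by
  obtain ⟨H, rfl⟩ := exists_eq_frestrictLe_preimage hB
  set f := Preorder.frestrictLe (π := fun _ : ℕ => E) k with hf
  have hfm : Measurable f := Preorder.measurable_frestrictLe k
  have hBm : MeasurableSet (f ⁻¹' H) := measurableSet_of_dependsOn hB
  have hCm := measurable_shift k hC
  -- both sides are measures in `H`, so it suffices to compare them on single finite paths
  have key : ((law P x).restrict (f ⁻¹' H ∩ shift k ⁻¹' C)).map f =
      law P y C • ((law P x).restrict (f ⁻¹' H)).map f := by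
    refine Measure.ext_of_singleton fun h => ?_
    rw [Measure.smul_apply, Measure.map_apply hfm (measurableSet_singleton _),
      Measure.map_apply hfm (measurableSet_singleton _),
      Measure.restrict_apply (hfm (measurableSet_singleton _)),
      Measure.restrict_apply (hfm (measurableSet_singleton _))]
    obtain ⟨z, rfl⟩ := exists_frestrictLe_eq k h
    by_cases hz : f z ∈ H
    · have h1 : f ⁻¹' {f z} ∩ f ⁻¹' H = f ⁻¹' {f z} :=
        Set.inter_eq_self_of_subset_left (by rintro ω hω; rw [Set.mem_preimage] at *; rwa [hω])
      rw [← Set.inter_assoc, h1, Set.inter_comm, hf, ← pathCylinder_eq_preimage,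
        ← Measure.restrict_apply hCm, ← Measure.map_apply (measurable_shift k) hC,
        law_restrict_pathCylinder_map_shift, hy z hz, Measure.smul_apply, smul_eq_mul, smul_eq_mul,
        mul_comm]
    · have h1 : f ⁻¹' {f z} ∩ f ⁻¹' H = ∅ := by
        ext ω
        simp only [Set.mem_inter_iff, Set.mem_preimage, Set.mem_singleton_iff,
          Set.mem_empty_iff_false, iff_false, not_and]
        intro h; rwa [h]
      rw [← Set.inter_assoc, h1]
      simp
  have := congrArg (fun m => m Set.univ) key
  simpa [Measure.map_apply hfm, mul_comm] using this

theorem dependsOn_coord_eq {E : Type*} (k : ℕ) (y : E) :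
    DependsOn (fun ω : ℕ → E => ω ∈ {ω : ℕ → E | ω k = y}) (Set.Iic k) := by
  intro ω ω' h
  simp [h k (Set.mem_Iic.2 le_rfl)]

theorem law_coord_inter_shift_preimage (x y : E) (k : ℕ) {C : Set (ℕ → E)}
    (hC : MeasurableSet C) :
    law P x ({ω | ω k = y} ∩ shift k ⁻¹' C) = law P x {ω | ω k = y} * law P y C :=
  law_inter_shift_preimage P x y (dependsOn_coord_eq k y) (fun _ h => h) hC

/-- If a property holds almost surely for the chain started at any point of `A`, then it holds
for the future of time `k` almost surely whenever the chain is in `A` at time `k`. -/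
theorem ae_shift_of_forall_mem (x : E) (k : ℕ) {A : Set E} {Q : (ℕ → E) → Prop}
    (h : ∀ a ∈ A, ∀ᵐ ω ∂(law P a), Q ω) :
    ∀ᵐ ω ∂(law P x), ω k ∈ A → Q (shift k ω) := by
  have h1 : ∀ a : E, ∀ᵐ ω ∂(law P x), a ∈ A → ω k = a → Q (shift k ω) := by
    intro a
    by_cases ha : a ∈ A
    · set N := toMeasurable (law P a) {ω | ¬ Q ω} with hN
      have hN0 : law P a N = 0 := by rw [measure_toMeasurable]; exact h a ha
      have h2 := law_coord_inter_shift_preimage P x a k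
        (measurableSet_toMeasurable (law P a) {ω | ¬ Q ω})
      rw [← hN, hN0, mul_zero] at h2
      refine measure_mono_null (fun ω hω => ?_) h2
      simp only [Set.mem_compl_iff, Set.mem_ofPred_eq, not_forall] at hω
      obtain ⟨-, h3, h4⟩ := hω
      exact ⟨h3, subset_toMeasurable _ _ h4⟩
    · exact ae_of_all _ fun ω h => absurd h ha
  filter_upwards [ae_all_iff.2 h1] with ω hω hA using hω _ hA rfl

/-- A property of the future that holds almost surely for the chain started at `x` holds
almost surely for the chain started at any point that is reached with positive probability. For
events that do not change under shifts, this carries almost sure statements from one state of a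
class to all others. -/
theorem ae_law_of_ae_shift {x y : E} {k : ℕ} (hk : 0 < law P x {ω | ω k = y})
    {Q : (ℕ → E) → Prop} (hQ : MeasurableSet {ω | Q ω})
    (h : ∀ᵐ ω ∂(law P x), Q (shift k ω)) : ∀ᵐ ω ∂(law P y), Q ω := by
  have h1 := law_coord_inter_shift_preimage P x y k hQ.compl
  have h2 : law P x ({ω | ω k = y} ∩ shift k ⁻¹' {ω | Q ω}ᶜ) = 0 :=
    measure_mono_null Set.inter_subset_right h
  rw [h2] at h1
  exact (mul_eq_zero.1 h1.symm).resolve_left hk.ne'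

end Basic

end MarkovChain

/-! ### Return times and the strong Markov property -/

namespace MarkovChain

/-- The first time `k ≥ 1` at which `ω` is at `x`, with the value `0` if there is none. -/
noncomputable def firstReturn {E : Type*} (x : E) (ω : ℕ → E) : ℕ := sInf {k | 1 ≤ k ∧ ω k = x}

/-- The path `ω` seen from its first return to `x` on (`ω` itself if there is no return). -/
noncomputable def nextExcursion {E : Type*} (x : E) (ω : ℕ → E) : ℕ → E :=
  shift (firstReturn x ω) ω

section Paths

variable {E : Type*} {x : E} {ω ω' : ℕ → E}

theorem firstReturn_pos_iff : 0 < firstReturn x ω ↔ ∃ k, 1 ≤ k ∧ ω k = x := by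
  constructor
  · intro h
    exact Nat.nonempty_of_pos_sInf h
  · intro h
    exact (Nat.sInf_mem h).1

theorem coord_firstReturn (h : 0 < firstReturn x ω) : ω (firstReturn x ω) = x :=
  (Nat.sInf_mem (firstReturn_pos_iff.1 h)).2

theorem firstReturn_eq_iff {k : ℕ} (hk : 1 ≤ k) :
    firstReturn x ω = k ↔ ω k = x ∧ ∀ j, 1 ≤ j → j < k → ω j ≠ x := by
  constructor
  · rintro rfl
    exact ⟨coord_firstReturn hk, fun j h1 h2 h3 => Nat.notMem_of_lt_sInf h2 ⟨h1, h3⟩⟩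
  · rintro ⟨h1, h2⟩
    refine le_antisymm (Nat.sInf_le ⟨hk, h1⟩) ?_
    have h3 : 0 < firstReturn x ω := firstReturn_pos_iff.2 ⟨k, hk, h1⟩
    by_contra! h4
    exact h2 _ h3 h4 (coord_firstReturn h3)

theorem firstReturn_congr (h0 : 0 < firstReturn x ω) (h : ∀ j ≤ firstReturn x ω, ω j = ω' j) :
    firstReturn x ω' = firstReturn x ω := by
  have h1 := (firstReturn_eq_iff (x := x) (ω := ω) h0).1 rfl
  exact (firstReturn_eq_iff h0).2 ⟨h _ le_rfl ▸ h1.1, fun j hj hj' => h j hj'.le ▸ h1.2 j hj hj'⟩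

theorem returnTime_eq (h : 0 < firstReturn x ω) : returnTime x ω = firstReturn x ω := by
  refine le_antisymm (iInf₂_le _ ⟨h, coord_firstReturn h⟩) (le_iInf₂ fun k hk => ?_)
  exact_mod_cast Nat.sInf_le hk

/-- The `k`-th excursion from `x` starts at the sum of the lengths of the first `k` ones. -/
theorem nextExcursion_iterate_apply (x : E) (ω : ℕ → E) (k i : ℕ) :
    (nextExcursion x)^[k] ω i =
      ω (∑ j ∈ Finset.range k, firstReturn x ((nextExcursion x)^[j] ω) + i) := by
  induction k generalizing i with
  | zero => simp
  | succ k ih =>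
    rw [Function.iterate_succ_apply', nextExcursion, shift, ih, Finset.sum_range_succ, add_assoc]

/-- The set `B` of paths is determined by the path up to the first return to `x`. -/
def DeterminedByReturn (x : E) (B : Set (ℕ → E)) : Prop :=
  ∀ ω ω', 0 < firstReturn x ω → (∀ j ≤ firstReturn x ω, ω j = ω' j) → ω ∈ B → ω' ∈ B

theorem DeterminedByReturn.dependsOn {B : Set (ℕ → E)} (hB : DeterminedByReturn x B) {k : ℕ}
    (hk : 1 ≤ k) :
    DependsOn (fun ω => ω ∈ B ∩ {ω | firstReturn x ω = k}) (Set.Iic k) := by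
  have key : ∀ ω ω' : ℕ → E, (∀ i ∈ Set.Iic k, ω i = ω' i) →
      ω ∈ B ∩ {ω | firstReturn x ω = k} → ω' ∈ B ∩ {ω | firstReturn x ω = k} := by
    rintro ω ω' h ⟨h1, rfl⟩
    exact ⟨hB ω ω' hk h h1, firstReturn_congr hk h⟩
  exact fun ω ω' h => propext ⟨key ω ω' h, key ω' ω fun i hi => (h i hi).symm⟩

theorem firstReturn_pos_inter_eq_iUnion (x : E) (B : Set (ℕ → E)) :
    {ω | 0 < firstReturn x ω} ∩ B = ⋃ k : ℕ, B ∩ {ω | firstReturn x ω = k + 1} := by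
  ext ω
  simp only [Set.mem_inter_iff, Set.mem_ofPred_eq, Set.mem_iUnion, exists_and_left]
  rw [and_comm, and_congr_right_iff]
  exact fun _ => ⟨fun h => ⟨_, (Nat.sub_add_cancel h).symm⟩, fun ⟨k, hk⟩ => by lia⟩

/-- If no excursion from `x` visits `y`, then the path does not visit `y`. -/
theorem coord_ne_of_forall_excursion {y : E}
    (h : ∀ k, 0 < firstReturn x ((nextExcursion x)^[k] ω) ∧
      ∀ j < firstReturn x ((nextExcursion x)^[k] ω), (nextExcursion x)^[k] ω j ≠ y) (m : ℕ) :
    ω m ≠ y := by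
  induction m using Nat.strong_induction_on generalizing ω with
  | _ m ih =>
    obtain ⟨h1, h2⟩ := h 0
    rw [Function.iterate_zero_apply] at h1 h2
    by_cases hm : m < firstReturn x ω
    · exact h2 m hm
    · have h3 := ih (m - firstReturn x ω) (by lia) (ω := nextExcursion x ω) fun k => h (k + 1)
      rw [nextExcursion, shift] at h3
      rwa [show firstReturn x ω + (m - firstReturn x ω) = m by lia] at h3

theorem frequently_shift_iff (k : ℕ) (ω : ℕ → E) (p : E → Prop) :
    (∃ᶠ i in atTop, p (shift k ω i)) ↔ ∃ᶠ i in atTop, p (ω i) := by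
  simp only [frequently_atTop, shift]
  constructor
  · intro h K
    obtain ⟨m, hm, hp⟩ := h K
    exact ⟨k + m, by lia, hp⟩
  · intro h K
    obtain ⟨m, hm, hp⟩ := h (K + k)
    exact ⟨m - k, by lia, by rwa [show k + (m - k) = m by lia]⟩

theorem determinedByReturn_univ (x : E) : DeterminedByReturn x Set.univ :=
  fun _ _ _ _ _ => trivial

end Paths

section General

variable {E : Type*} [MeasurableSpace E] {P : Kernel E E} [IsMarkovKernel P] {x y : E}

theorem IsRecurrent.ae_firstReturn_pos (hx : IsRecurrent P x) :
    ∀ᵐ ω ∂(law P x), 0 < firstReturn x ω := by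
  filter_upwards [hx] with ω hω using firstReturn_pos_iff.2 hω

theorem isRecurrent_of_ae_frequently (h : ∀ᵐ ω ∂(law P x), ∃ᶠ k in atTop, ω k = x) :
    IsRecurrent P x := by
  filter_upwards [h] with ω hω using frequently_atTop.1 hω 1

theorem IsRecurrentClass.accessible {A : Set E} (hA : IsRecurrentClass P A) (hx : x ∈ A)
    (hy : y ∈ A) : Accessible P x y :=
  (hA.1.2.1 x hx y hy).1

theorem accessible_of_ae_exists (h : ∀ᵐ ω ∂(law P x), ∃ k, 1 ≤ k ∧ ω k = y) :
    Accessible P x y := by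
  by_contra hn
  have h1 : ∀ k : ℕ, ∀ᵐ ω ∂(law P x), 1 ≤ k → ω k ≠ y := by
    intro k
    by_cases hk : 1 ≤ k
    · have : law P x {ω | ω k = y} = 0 := by
        by_contra h0
        exact hn ⟨k, hk, pos_iff_ne_zero.2 h0⟩
      filter_upwards [measure_eq_zero_iff_ae_notMem.1 this] with ω hω _ using hω
    · exact ae_of_all _ fun ω h => absurd h hk
  obtain ⟨ω, ⟨k, hk, hky⟩, h2⟩ := (h.and (ae_all_iff.2 h1)).exists
  exact h2 k hk hky

theorem IsRecurrent.accessible_self (hx : IsRecurrent P x) : Accessible P x x :=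
  accessible_of_ae_exists hx

theorem accessible_of_ae_frequently (h : ∀ᵐ ω ∂(law P x), ∃ᶠ k in atTop, ω k = y) :
    Accessible P x y := by
  refine accessible_of_ae_exists ?_
  filter_upwards [h] with ω hω using frequently_atTop.1 hω 1

end General

variable {E : Type*} [MeasurableSpace E] [MeasurableSingletonClass E]

theorem measurableSet_frequently_coord_eq (y : E) :
    MeasurableSet {ω : ℕ → E | ∃ᶠ k in atTop, ω k = y} := by
  have : {ω : ℕ → E | ∃ᶠ k in atTop, ω k = y} = ⋂ K : ℕ, ⋃ k : ℕ, ⋃ (_ : K ≤ k), {ω | ω k = y} := by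
    ext ω
    simp [frequently_atTop]
  rw [this]
  exact MeasurableSet.iInter fun K => MeasurableSet.iUnion fun k => MeasurableSet.iUnion fun _ =>
    measurableSet_coord_eq k y

theorem measurable_firstReturn (x : E) : Measurable (firstReturn x) := by
  have h : ∀ k, 1 ≤ k → MeasurableSet (firstReturn x ⁻¹' {k}) := by
    intro k hk
    have : firstReturn x ⁻¹' {k} =
        {ω | ω k = x} ∩ ⋂ j, ⋂ (_ : 1 ≤ j), ⋂ (_ : j < k), {ω | ω j = x}ᶜ := by
      ext ω
      simp [firstReturn_eq_iff hk]
    rw [this]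
    exact (measurableSet_coord_eq k x).inter (MeasurableSet.iInter fun j =>
      MeasurableSet.iInter fun _ => MeasurableSet.iInter fun _ => (measurableSet_coord_eq j x).compl)
  refine measurable_to_countable' fun k => ?_
  rcases Nat.eq_zero_or_pos k with rfl | hk
  · have : firstReturn x ⁻¹' {0} = (⋃ k : ℕ, firstReturn x ⁻¹' {k + 1})ᶜ := by
      ext ω
      simp only [Set.mem_preimage, Set.mem_singleton_iff, Set.mem_compl_iff, Set.mem_iUnion]
      exact ⟨fun h1 ⟨k, hk⟩ => by lia, fun h1 => by_contra fun h2 => h1 ⟨_,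
        (Nat.succ_pred_eq_of_ne_zero h2).symm⟩⟩
    rw [this]
    exact (MeasurableSet.iUnion fun k => h _ (by lia)).compl
  · exact h k hk

theorem measurable_nextExcursion (x : E) : Measurable (nextExcursion x) := by
  refine measurable_pi_lambda _ fun i => ?_
  have h : Measurable fun q : ℕ × (ℕ → E) => q.2 (q.1 + i) :=
    measurable_from_prod_countable_right fun k => measurable_pi_apply (k + i)
  exact h.comp ((measurable_firstReturn x).prodMk measurable_id)

variable [Countable E] (P : Kernel E E) [IsMarkovKernel P]

/-- The strong Markov property at the first return to `x`. -/
theorem law_inter_nextExcursion_preimage (z x : E) {B : Set (ℕ → E)}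
    (hB : DeterminedByReturn x B) {C : Set (ℕ → E)} (hC : MeasurableSet C) :
    law P z ({ω | 0 < firstReturn x ω} ∩ B ∩ nextExcursion x ⁻¹' C) =
      law P z ({ω | 0 < firstReturn x ω} ∩ B) * law P x C := by
  have hm : ∀ k : ℕ, MeasurableSet (B ∩ {ω | firstReturn x ω = k + 1}) :=
    fun k => measurableSet_of_dependsOn (hB.dependsOn (by lia))
  have hd : Pairwise (Function.onFun Disjoint fun k : ℕ => B ∩ {ω | firstReturn x ω = k + 1}) := by
    intro i j hij
    refine Set.disjoint_left.2 fun ω h1 h2 => hij ?_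
    have h3 : firstReturn x ω = i + 1 := h1.2
    have h4 : firstReturn x ω = j + 1 := h2.2
    lia
  rw [firstReturn_pos_inter_eq_iUnion, Set.iUnion_inter, measure_iUnion hd hm,
    ← ENNReal.tsum_mul_right, measure_iUnion]
  · refine tsum_congr fun k => ?_
    rw [← law_inter_shift_preimage P z x (hB.dependsOn (by lia))
      (fun ω hω => by
        have h2 : firstReturn x ω = k + 1 := hω.2
        rw [← h2]
        exact coord_firstReturn (by lia)) hC]
    congr 1
    ext ω
    simp only [Set.mem_inter_iff, Set.mem_ofPred_eq, Set.mem_preimage, nextExcursion]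
    grind
  · intro i j hij
    exact (hd hij).mono Set.inter_subset_left Set.inter_subset_left
  · exact fun k => (hm k).inter (measurable_nextExcursion x hC)

/-! ### Recurrence and communication classes -/

variable {P} {x y : E}

theorem IsRecurrent.law_inter_nextExcursion_preimage (hx : IsRecurrent P x) {B : Set (ℕ → E)}
    (hB : DeterminedByReturn x B) {C : Set (ℕ → E)} (hC : MeasurableSet C) :
    law P x (B ∩ nextExcursion x ⁻¹' C) = law P x B * law P x C := by
  have h := MarkovChain.law_inter_nextExcursion_preimage P x x hB hC
  rw [Set.inter_assoc] at h
  have h1 : ∀ D : Set (ℕ → E), law P x ({ω | 0 < firstReturn x ω} ∩ D) = law P x D :=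
    fun D => Measure.measure_inter_eq_of_ae (s := D) hx.ae_firstReturn_pos
  rwa [h1, h1] at h

theorem IsRecurrent.measurePreserving_nextExcursion (hx : IsRecurrent P x) :
    MeasurePreserving (nextExcursion x) (law P x) (law P x) := by
  refine ⟨measurable_nextExcursion x, Measure.ext fun C hC => ?_⟩
  rw [Measure.map_apply (measurable_nextExcursion x) hC]
  have h := hx.law_inter_nextExcursion_preimage (determinedByReturn_univ x) hC
  simpa using h

theorem IsRecurrent.ae_iterate_nextExcursion (hx : IsRecurrent P x) {Q : (ℕ → E) → Prop}
    (hQ : ∀ᵐ ω ∂(law P x), Q ω) :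
    ∀ᵐ ω ∂(law P x), ∀ k, Q ((nextExcursion x)^[k] ω) :=
  ae_all_iff.2 fun k =>
    (hx.measurePreserving_nextExcursion.iterate k).quasiMeasurePreserving.ae hQ

/-- A chain started at a recurrent state almost surely visits every accessible state infinitely
often. All excursions have the same positive probability of visiting that state, independently
of the future. -/
theorem IsRecurrent.ae_frequently_of_accessible (hx : IsRecurrent P x)
    (hxy : Accessible P x y) : ∀ᵐ ω ∂(law P x), ∃ᶠ k in atTop, ω k = y := by
  set N : Set (ℕ → E) := {ω | ∀ k, ω k ≠ y} with hN
  set B : Set (ℕ → E) := {ω | ∀ j < firstReturn x ω, ω j ≠ y} with hB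
  have hNm : MeasurableSet N := by
    have : N = ⋂ k, {ω | ω k = y}ᶜ := by ext; simp [hN]
    rw [this]
    exact MeasurableSet.iInter fun k => (measurableSet_coord_eq k y).compl
  have hBd : DeterminedByReturn x B := by
    intro ω ω' h0 h h1 j hj
    rw [firstReturn_congr h0 h] at hj
    exact h j hj.le ▸ h1 j hj
  -- `y` is avoided if and only if the first excursion and the path after it both avoid `y`
  have h1 : law P x N = law P x B * law P x N := by
    rw [← hx.law_inter_nextExcursion_preimage hBd hNm]
    congr 1
    ext ω
    simp only [hN, hB, Set.mem_inter_iff, Set.mem_ofPred_eq, Set.mem_preimage, nextExcursion,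
      shift]
    refine ⟨fun h => ⟨fun j _ => h j, fun k => h _⟩, fun h k => ?_⟩
    by_cases hk : k < firstReturn x ω
    · exact h.1 k hk
    · have := h.2 (k - firstReturn x ω)
      rwa [show firstReturn x ω + (k - firstReturn x ω) = k by lia] at this
  have hN0 : law P x N = 0 := by
    by_contra hne
    -- then no excursion visits `y`
    have hB1 : law P x B = 1 := by
      have h2 : law P x N * law P x B = law P x N * 1 := by rw [mul_comm, ← h1, mul_one]
      exact (ENNReal.mul_right_inj hne (measure_ne_top _ _)).1 h2
    have hBae : ∀ᵐ ω ∂(law P x), ω ∈ {ω | 0 < firstReturn x ω} ∩ B := by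
      have hBm : MeasurableSet ({ω | 0 < firstReturn x ω} ∩ B) := by
        rw [firstReturn_pos_inter_eq_iUnion]
        exact MeasurableSet.iUnion fun k =>
          measurableSet_of_dependsOn (hBd.dependsOn (Nat.le_add_left 1 k))
      refine (mem_ae_iff_prob_eq_one hBm).2 ?_
      rw [← hB1]
      exact Measure.measure_inter_eq_of_ae (s := B) hx.ae_firstReturn_pos
    obtain ⟨k, -, hk⟩ := hxy
    refine hk.ne' ?_
    refine measure_eq_zero_iff_ae_notMem.2 ?_
    filter_upwards [hx.ae_iterate_nextExcursion hBae] with ω hω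
    exact coord_ne_of_forall_excursion hω k
  have hNae : ∀ᵐ ω ∂(law P x), ω ∉ N := measure_eq_zero_iff_ae_notMem.1 hN0
  filter_upwards [hx.ae_iterate_nextExcursion hNae,
    hx.ae_iterate_nextExcursion hx.ae_firstReturn_pos] with ω h2 h3
  rw [frequently_atTop]
  intro K
  induction K generalizing ω with
  | zero =>
    have := h2 0
    simp only [hN, Set.mem_ofPred_eq, not_forall, not_not] at this
    obtain ⟨k, hk⟩ := this
    exact ⟨k, Nat.zero_le _, hk⟩
  | succ K ih =>
    obtain ⟨m, hm, hmy⟩ := ih (nextExcursion x ω) (fun k => h2 (k + 1)) fun k => h3 (k + 1)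
    have := h3 0
    exact ⟨firstReturn x ω + m, by simp only [Function.iterate_zero_apply] at this; lia, hmy⟩

theorem Accessible.trans {z : E} (h1 : Accessible P x y) (h2 : Accessible P y z) :
    Accessible P x z := by
  obtain ⟨k, hk, hk0⟩ := h1
  obtain ⟨m, hm, hm0⟩ := h2
  refine ⟨k + m, by lia, ?_⟩
  refine lt_of_lt_of_le (ENNReal.mul_pos hk0.ne' hm0.ne') ?_
  rw [← law_coord_inter_shift_preimage P x y k (measurableSet_coord_eq m z)]
  exact measure_mono Set.inter_subset_right

/-- Every state accessible from a recurrent state `x` is visited infinitely often from every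
state accessible from `x`. -/
theorem IsRecurrent.ae_frequently (hx : IsRecurrent P x) {z : E} (hy : Accessible P x y)
    (hz : Accessible P x z) : ∀ᵐ ω ∂(law P y), ∃ᶠ k in atTop, ω k = z := by
  obtain ⟨k, -, hk⟩ := hy
  refine ae_law_of_ae_shift P hk (measurableSet_frequently_coord_eq z) ?_
  filter_upwards [hx.ae_frequently_of_accessible hz] with ω hω
  exact (frequently_shift_iff k ω (· = z)).2 hω

/-- The states accessible from a recurrent state form a recurrent class. -/
theorem IsRecurrent.isRecurrentClass_accessible (hx : IsRecurrent P x) :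
    IsRecurrentClass P {y | Accessible P x y} := by
  refine ⟨⟨⟨x, hx.accessible_self⟩, ?_, ?_⟩, fun y hy z hz => Accessible.trans hy hz,
    fun y hy => isRecurrent_of_ae_frequently (hx.ae_frequently hy hy)⟩
  · exact fun y hy z hz => ⟨accessible_of_ae_frequently (hx.ae_frequently hy hz),
      accessible_of_ae_frequently (hx.ae_frequently hz hy)⟩
  · exact fun B hB hle b hb => (hB x (hle hx.accessible_self) b hb).1

/-- A chain started at a recurrent state visits exactly the states of its class. -/
theorem IsRecurrent.ae_range_eq (hx : IsRecurrent P x) :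
    ∀ᵐ ω ∂(law P x), Set.range ω = {y | Accessible P x y} := by
  have h1 : ∀ᵐ ω ∂(law P x), ∀ y, Accessible P x y → ∃ᶠ k in atTop, ω k = y := by
    refine ae_all_iff.2 fun y => ?_
    by_cases hy : Accessible P x y
    · filter_upwards [hx.ae_frequently_of_accessible hy] with ω hω _ using hω
    · exact ae_of_all _ fun ω h => absurd h hy
  have h2 : ∀ᵐ ω ∂(law P x), ∀ k, ∀ y, ω k = y → Accessible P x y := by
    refine ae_all_iff.2 fun k => ae_all_iff.2 fun y => ?_
    by_cases hy : Accessible P x y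
    · exact ae_of_all _ fun ω h => hy
    rcases Nat.eq_zero_or_pos k with rfl | hk
    · filter_upwards [law_coord_zero P x] with ω hω h
      rw [← h, hω]
      exact hx.accessible_self
    · have : law P x {ω | ω k = y} = 0 := by
        by_contra h0
        exact hy ⟨k, hk, pos_iff_ne_zero.2 h0⟩
      filter_upwards [measure_eq_zero_iff_ae_notMem.1 this] with ω hω h using absurd h hω
  filter_upwards [h1, h2] with ω h1 h2
  refine Set.Subset.antisymm ?_ fun y hy => (h1 y hy).exists
  rintro _ ⟨k, rfl⟩
  exact h2 k _ rfl

end MarkovChain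

/-! ### Visit frequencies -/

/-- If `S M / M` converges along times `t k` that grow linearly, and `S` is monotone, then it
converges. -/
theorem tendsto_div_of_tendsto_div_along {S : ℕ → ℝ} (hS : Monotone S) (hS0 : ∀ n, 0 ≤ S n)
    {t : ℕ → ℕ} (ht : StrictMono t) (ht0 : t 0 = 0) {τ ν : ℝ} (hτ : 0 < τ)
    (h1 : Tendsto (fun k : ℕ => (t k : ℝ) / k) atTop (𝓝 τ))
    (h2 : Tendsto (fun k : ℕ => S (t k) / k) atTop (𝓝 ν)) :
    Tendsto (fun M : ℕ => S M / M) atTop (𝓝 (ν / τ)) := by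
  -- `k M` is the index of the last of the times `t k` up to `M`
  let k : ℕ → ℕ := fun M => Nat.findGreatest (fun j => t j ≤ M) M
  have hk1 : ∀ M, t (k M) ≤ M := fun M =>
    Nat.findGreatest_spec (P := fun j => t j ≤ M) (m := 0) (Nat.zero_le _)
      (by rw [ht0]; exact Nat.zero_le _)
  have hk2 : ∀ M, M < t (k M + 1) := by
    intro M
    by_contra! h
    have := Nat.le_findGreatest (P := fun j => t j ≤ M) (ht.le_apply.trans h) h
    exact absurd this (by simp [k])
  have hk : Tendsto k atTop atTop := by
    refine tendsto_atTop.2 fun b => ?_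
    filter_upwards [eventually_ge_atTop (t b)] with M hM
    exact Nat.le_findGreatest (ht.le_apply.trans hM) hM
  have hone : Tendsto (fun k : ℕ => (k : ℝ) / (k + 1)) atTop (𝓝 1) :=
    tendsto_natCast_div_add_atTop (1 : ℝ)
  have h1' : Tendsto (fun k : ℕ => (t (k + 1) : ℝ) / (k + 1)) atTop (𝓝 τ) := by
    have := (tendsto_add_atTop_iff_nat 1).2 h1
    simpa using this
  have h2' : Tendsto (fun k : ℕ => S (t (k + 1)) / (k + 1)) atTop (𝓝 ν) := by
    have := (tendsto_add_atTop_iff_nat 1).2 h2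
    simpa using this
  have hpos : ∀ k, 1 ≤ k → (0 : ℝ) < t k := fun k hk => by
    have : k ≤ t k := ht.le_apply
    exact_mod_cast (by lia : 0 < t k)
  -- bounds for `S M / M` when `t k ≤ M < t (k + 1)`
  have hL : Tendsto (fun k : ℕ => S (t k) / t (k + 1)) atTop (𝓝 (ν / τ)) := by
    have h3 := (h2.mul hone).div h1' hτ.ne'
    rw [mul_one] at h3
    refine h3.congr' ?_
    filter_upwards [eventually_ge_atTop 1] with k hk
    have hk0 : (0 : ℝ) < k := by exact_mod_cast hk
    have := hpos (k + 1) (by lia)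
    simp only [Pi.div_apply]
    field_simp
  have hU : Tendsto (fun k : ℕ => S (t (k + 1)) / t k) atTop (𝓝 (ν / τ)) := by
    have h3 := h2'.div (h1.mul hone) (by simpa using hτ.ne')
    rw [mul_one] at h3
    refine h3.congr' ?_
    filter_upwards [eventually_ge_atTop 1] with k hk
    have hk0 : (0 : ℝ) < k := by exact_mod_cast hk
    have := hpos k hk
    simp only [Pi.div_apply]
    field_simp
  refine tendsto_of_tendsto_of_tendsto_of_le_of_le' (hL.comp hk) (hU.comp hk) ?_ ?_
  · filter_upwards [eventually_ge_atTop 1] with M hM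
    have hM0 : (0 : ℝ) < M := by exact_mod_cast hM
    have h3 : (M : ℝ) ≤ t (k M + 1) := by exact_mod_cast (hk2 M).le
    exact div_le_div₀ (hS0 _) (hS (hk1 M)) hM0 h3
  · filter_upwards [hk.eventually_ge_atTop 1] with M hM
    have h3 : (t (k M) : ℝ) ≤ M := by exact_mod_cast hk1 M
    exact div_le_div₀ (hS0 _) (hS (hk2 M).le) (hpos _ hM) h3

namespace MarkovChain

/-- The path `ω` visits each state `y` with asymptotic frequency `c y`. -/
def HasVisitFrequencies {E : Type*} (ω : ℕ → E) (c : E → ℝ) : Prop :=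
  ∀ y, Tendsto (fun M : ℕ => (1 / (M : ℝ)) *
    ∑ i ∈ Finset.range M, Set.indicator {y} (fun _ => (1 : ℝ)) (ω i)) atTop (𝓝 (c y))

section Paths

variable {E : Type*}

/-- Cesàro limits do not change when the first term is dropped. -/
theorem tendsto_average_succ_iff (a : ℕ → ℝ) (c : ℝ) :
    Tendsto (fun M : ℕ => (1 / (M : ℝ)) * ∑ i ∈ Finset.range M, a (1 + i)) atTop (𝓝 c) ↔
      Tendsto (fun M : ℕ => (1 / (M : ℝ)) * ∑ i ∈ Finset.range M, a i) atTop (𝓝 c) := by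
  have hone : Tendsto (fun k : ℕ => (k : ℝ) / (k + 1)) atTop (𝓝 1) :=
    tendsto_natCast_div_add_atTop (1 : ℝ)
  have hone' : Tendsto (fun k : ℕ => ((k : ℝ) / (k + 1))⁻¹) atTop (𝓝 1) := by
    simpa using hone.inv₀ one_ne_zero
  have h0 : Tendsto (fun k : ℕ => a 0 / (k : ℝ)) atTop (𝓝 0) :=
    tendsto_const_div_atTop_nhds_zero_nat _
  rw [← tendsto_add_atTop_iff_nat (f := fun M : ℕ => (1 / (M : ℝ)) *
    ∑ i ∈ Finset.range M, a i) 1]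
  have hsum : ∀ M, ∑ i ∈ Finset.range (M + 1), a i =
      a 0 + ∑ i ∈ Finset.range M, a (1 + i) := by
    intro M
    rw [Finset.sum_range_succ', add_comm]
    simp only [add_comm 1]
  constructor
  · intro h
    have h3 := (h.add h0).mul hone
    rw [add_zero, mul_one] at h3
    refine h3.congr' ?_
    filter_upwards [eventually_ge_atTop 1] with M hM
    have hM0 : (0 : ℝ) < M := by exact_mod_cast hM
    rw [hsum]
    push_cast
    field_simp
    ring
  · intro h
    have h3 := (h.mul hone').sub h0
    rw [mul_one, sub_zero] at h3
    refine h3.congr' ?_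
    filter_upwards [eventually_ge_atTop 1] with M hM
    have hM0 : (0 : ℝ) < M := by exact_mod_cast hM
    rw [hsum]
    push_cast
    field_simp
    ring

theorem hasVisitFrequencies_shift_iff (k : ℕ) (ω : ℕ → E) (c : E → ℝ) :
    HasVisitFrequencies (shift k ω) c ↔ HasVisitFrequencies ω c := by
  induction k generalizing ω with
  | zero =>
    have h : shift 0 ω = ω := funext fun i => congrArg ω (Nat.zero_add i)
    rw [h]
  | succ k ih =>
    have h : shift (k + 1) ω = shift 1 (shift k ω) := by
      ext i
      simp only [shift]
      congr 1
      lia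
    rw [h, ← ih ω]
    exact forall_congr' fun y => tendsto_average_succ_iff
      (fun i => Set.indicator {y} (fun _ => (1 : ℝ)) (shift k ω i)) (c y)

theorem HasVisitFrequencies.eq {ω : ℕ → E} {c c' : E → ℝ} (h : HasVisitFrequencies ω c)
    (h' : HasVisitFrequencies ω c') : c = c' :=
  funext fun y => tendsto_nhds_unique (h y) (h' y)

/-- The sum of `g` along the path up to the `k`-th return decomposes into the sums over the first
`k` excursions. -/
theorem sum_range_returns (x : E) (g : E → ℝ) (ω : ℕ → E) (k : ℕ) :
    ∑ i ∈ Finset.range (∑ j ∈ Finset.range k, firstReturn x ((nextExcursion x)^[j] ω)), g (ω i) =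
      ∑ j ∈ Finset.range k, ∑ i ∈ Finset.range (firstReturn x ((nextExcursion x)^[j] ω)),
        g ((nextExcursion x)^[j] ω i) := by
  induction k with
  | zero => simp
  | succ k ih =>
    rw [Finset.sum_range_succ, Finset.sum_range_add, ih, Finset.sum_range_succ _ k]
    simp only [nextExcursion_iterate_apply]

end Paths

variable {E : Type*} [MeasurableSpace E] [MeasurableSingletonClass E]

theorem IsPositiveRecurrent.integrable_firstReturn {P : Kernel E E} [IsMarkovKernel P] {x : E}
    (hx : IsPositiveRecurrent P x) :
    Integrable (fun ω => (firstReturn x ω : ℝ)) (law P x) := by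
  refine ⟨(measurable_from_nat.comp (measurable_firstReturn x)).aestronglyMeasurable, ?_⟩
  refine lt_of_le_of_lt (le_of_eq (lintegral_congr_ae ?_)) hx.2
  filter_upwards [hx.1.ae_firstReturn_pos] with ω hω
  rw [returnTime_eq hω]
  simp

variable [Countable E]

theorem measurableSet_hasVisitFrequencies (c : E → ℝ) :
    MeasurableSet {ω : ℕ → E | HasVisitFrequencies ω c} := by
  have : {ω : ℕ → E | HasVisitFrequencies ω c} = ⋂ y, {ω : ℕ → E |
      Tendsto (fun M : ℕ => (1 / (M : ℝ)) *
        ∑ i ∈ Finset.range M, Set.indicator {y} (fun _ => (1 : ℝ)) (ω i)) atTop (𝓝 (c y))} := by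
    ext ω
    simp [HasVisitFrequencies]
  rw [this]
  refine MeasurableSet.iInter fun y => measurableSet_tendsto _ fun M => ?_
  refine (Finset.measurable_sum _ fun i _ => ?_).const_mul _
  exact (Measurable.of_discrete (f := Set.indicator {y} fun _ : E => (1 : ℝ))).comp
    (measurable_pi_apply i)

theorem measurable_excursionSum (x : E) (g : E → ℝ) :
    Measurable fun ω : ℕ → E => ∑ i ∈ Finset.range (firstReturn x ω), g (ω i) := by
  have h : Measurable fun q : ℕ × (ℕ → E) => ∑ i ∈ Finset.range q.1, g (q.2 i) :=
    measurable_from_prod_countable_right fun k => Finset.measurable_sum (Finset.range k) fun i _ =>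
      (Measurable.of_discrete (f := g)).comp (measurable_pi_apply i)
  exact h.comp ((measurable_firstReturn x).prodMk measurable_id)

variable {P : Kernel E E} [IsMarkovKernel P] {x : E}

/-- The strong law of large numbers for functionals of the successive excursions from a recurrent
state, which are independent and identically distributed. -/
theorem IsRecurrent.tendsto_excursion_average (hx : IsRecurrent P x) {V : (ℕ → E) → ℝ}
    (hV : Measurable V)
    (hdet : ∀ ω ω', 0 < firstReturn x ω → (∀ j ≤ firstReturn x ω, ω j = ω' j) → V ω' = V ω)
    (hint : Integrable V (law P x)) :
    ∀ᵐ ω ∂(law P x), Tendsto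
      (fun n : ℕ => (∑ i ∈ Finset.range n, V ((nextExcursion x)^[i] ω)) / n) atTop
      (𝓝 (∫ ω, V ω ∂(law P x))) := by
  set Φ := nextExcursion x with hΦ
  have hmp : ∀ k, MeasurePreserving Φ^[k] (law P x) (law P x) :=
    hx.measurePreserving_nextExcursion.iterate
  -- the excursions `i` and `i + m + 1` are the first excursion of the path `Φ^[i] ω` and a function
  -- of its path after the first return
  have hindep : ∀ i m, IndepFun (fun ω => V (Φ^[i] ω)) (fun ω => V (Φ^[i + (m + 1)] ω))
      (law P x) := by
    intro i m
    rw [indepFun_iff_measure_inter_preimage_eq_mul]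
    intro s t hs ht
    have hC : MeasurableSet ((fun ω => V (Φ^[m] ω)) ⁻¹' t) := hV.comp (hmp m).measurable ht
    have hB : DeterminedByReturn x (V ⁻¹' s) := fun ω ω' h0 h h1 => by
      rw [Set.mem_preimage, hdet ω ω' h0 h]
      exact h1
    have h1 := hx.law_inter_nextExcursion_preimage hB hC
    have h2 : (fun ω => V (Φ^[i] ω)) ⁻¹' s ∩ (fun ω => V (Φ^[i + (m + 1)] ω)) ⁻¹' t =
        Φ^[i] ⁻¹' (V ⁻¹' s ∩ Φ ⁻¹' ((fun ω => V (Φ^[m] ω)) ⁻¹' t)) := by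
      ext ω
      simp only [Set.mem_inter_iff, Set.mem_preimage, ← Function.iterate_succ_apply,
        ← Function.iterate_add_apply]
      rw [show m.succ + i = i + (m + 1) by lia]
    have h3 : (fun ω => V (Φ^[i + (m + 1)] ω)) ⁻¹' t =
        Φ^[i + 1] ⁻¹' ((fun ω => V (Φ^[m] ω)) ⁻¹' t) := by
      ext ω
      simp only [Set.mem_preimage, ← Function.iterate_add_apply]
      rw [show m + (i + 1) = i + (m + 1) by lia]
    have hCm := (measurable_nextExcursion x hC)
    rw [h2, (hmp i).measure_preimage ((hV hs).inter hCm).nullMeasurableSet, h1, h3,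
      (hmp (i + 1)).measure_preimage hC.nullMeasurableSet]
    congr 1
    exact ((hmp i).measure_preimage (hV hs).nullMeasurableSet).symm
  refine strong_law_ae_real (fun i ω => V (Φ^[i] ω)) hint (fun i j hij => ?_) fun i => ?_
  · rcases lt_or_gt_of_ne hij with h | h
    · obtain ⟨m, rfl⟩ := Nat.exists_eq_add_of_lt h
      exact hindep i m
    · obtain ⟨m, rfl⟩ := Nat.exists_eq_add_of_lt h
      exact (hindep j m).symm
  · refine ⟨(hV.comp (hmp i).measurable).aemeasurable, hV.aemeasurable, ?_⟩
    change Measure.map (V ∘ Φ^[i]) (law P x) = Measure.map V (law P x)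
    rw [← Measure.map_map hV (hmp i).measurable, (hmp i).map_eq]

/-- The chain started at a positive recurrent state almost surely has visit frequencies. -/
theorem IsPositiveRecurrent.exists_hasVisitFrequencies (hx : IsPositiveRecurrent P x) :
    ∃ c : E → ℝ, ∀ᵐ ω ∂(law P x), HasVisitFrequencies ω c := by
  have hT := hx.integrable_firstReturn
  have hpos : 0 < ∫ ω, (firstReturn x ω : ℝ) ∂(law P x) := by
    have h1 : ∫ _, (1 : ℝ) ∂(law P x) ≤ ∫ ω, (firstReturn x ω : ℝ) ∂(law P x) := by
      refine integral_mono_ae (integrable_const _) hT ?_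
      filter_upwards [hx.1.ae_firstReturn_pos] with ω hω
      exact_mod_cast hω
    simp only [integral_const, probReal_univ, smul_eq_mul, mul_one] at h1
    linarith
  refine ⟨fun y => (∫ ω, ∑ i ∈ Finset.range (firstReturn x ω),
    Set.indicator {y} (fun _ => (1 : ℝ)) (ω i) ∂(law P x)) /
    ∫ ω, (firstReturn x ω : ℝ) ∂(law P x), ae_all_iff.2 fun y => ?_⟩
  set g : E → ℝ := Set.indicator {y} fun _ => (1 : ℝ) with hg
  have hg0 : ∀ z, 0 ≤ g z := fun z => Set.indicator_nonneg (fun _ _ => zero_le_one) z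
  have hg1 : ∀ z, g z ≤ 1 := fun z => Set.indicator_le_self' (fun _ _ => zero_le_one) z
  have hVint : Integrable (fun ω : ℕ → E => ∑ i ∈ Finset.range (firstReturn x ω), g (ω i))
      (law P x) := by
    refine hT.mono' (measurable_excursionSum x g).aestronglyMeasurable (ae_of_all _ fun ω => ?_)
    rw [Real.norm_of_nonneg (Finset.sum_nonneg fun i _ => hg0 _)]
    calc ∑ i ∈ Finset.range (firstReturn x ω), g (ω i)
        ≤ ∑ i ∈ Finset.range (firstReturn x ω), (1 : ℝ) := Finset.sum_le_sum fun i _ => hg1 _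
      _ = firstReturn x ω := by simp
  have h1 := hx.1.tendsto_excursion_average
    (V := fun ω => (firstReturn x ω : ℝ)) (measurable_from_nat.comp (measurable_firstReturn x))
    (fun ω ω' h0 h => by rw [firstReturn_congr h0 h]) hT
  have h2 := hx.1.tendsto_excursion_average (measurable_excursionSum x g)
    (fun ω ω' h0 h => by
      rw [firstReturn_congr h0 h]
      exact Finset.sum_congr rfl fun i hi => by rw [h i (Finset.mem_range.1 hi).le]) hVint
  filter_upwards [h1, h2, hx.1.ae_iterate_nextExcursion hx.1.ae_firstReturn_pos] with ω h1 h2 h3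
  have h4 := tendsto_div_of_tendsto_div_along
    (S := fun M => ∑ i ∈ Finset.range M, g (ω i))
    (monotone_nat_of_le_succ fun n => by
      rw [Finset.sum_range_succ]
      linarith [hg0 (ω n)])
    (fun n => Finset.sum_nonneg fun i _ => hg0 _)
    (t := fun k => ∑ j ∈ Finset.range k, firstReturn x ((nextExcursion x)^[j] ω))
    (strictMono_nat_of_lt_succ fun n => by
      rw [Finset.sum_range_succ]
      exact Nat.lt_add_of_pos_right (h3 n))
    (by simp) hpos (by simpa using h1) (by simpa only [sum_range_returns] using h2)
  refine h4.congr fun M => ?_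
  rw [div_eq_inv_mul, one_div]

end MarkovChain

/-! ### Stationary distributions -/

namespace MarkovChain

/-- The paths that do not visit `x` at the times `1, …, i`. -/
def noReturn {E : Type*} (x : E) (i : ℕ) : Set (ℕ → E) := {ω | ∀ j, 1 ≤ j → j ≤ i → ω j ≠ x}

theorem dependsOn_noReturn {E : Type*} (x : E) (i : ℕ) :
    DependsOn (fun ω => ω ∈ noReturn x i) (Set.Iic i) := by
  intro ω ω' h
  refine propext (forall₃_congr fun j _ hj => ?_)
  rw [h j hj]

theorem mem_noReturn_iff {E : Type*} {x : E} {ω : ℕ → E} (h : 0 < firstReturn x ω) {i : ℕ} :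
    ω ∈ noReturn x i ↔ i < firstReturn x ω := by
  constructor
  · intro h1
    by_contra! h2
    exact h1 _ h h2 (coord_firstReturn h)
  · exact fun h1 j hj hji => ((firstReturn_eq_iff h).1 rfl).2 j hj (hji.trans_lt h1)

variable {E : Type*} [MeasurableSpace E] [MeasurableSingletonClass E]

theorem measurableSet_noReturn [Countable E] (x : E) (i : ℕ) : MeasurableSet (noReturn x i) :=
  measurableSet_of_dependsOn (dependsOn_noReturn x i)

variable (P : Kernel E E) [IsMarkovKernel P]

theorem law_coord_one (y z : E) : law P y {ω | ω 1 = z} = P y {z} := by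
  let c : ℕ → E := fun i => if i = 0 then y else z
  have h := law_pathCylinder_succ P y c 0
  rw [law_pathCylinder_zero] at h
  simp only [zero_add, c, if_true, one_ne_zero, if_false, Set.mem_singleton_iff,
    Set.indicator_of_mem, Pi.one_apply, one_mul] at h
  rw [← h]
  refine measure_congr (eventuallyEq_set.2 ?_)
  filter_upwards [law_coord_zero P y] with ω hω
  simp only [pathCylinder, Set.mem_ofPred_eq]
  constructor
  · intro h1 j hj
    interval_cases j <;> simp [h1, hω]
  · intro h1
    simpa using h1 1 le_rfl

/-- The measure that gives a set of states the expected number of visits to it during an excursion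
from `x`. Time `i` belongs to the excursion if the path has not returned to `x` at the times
`1, …, i`. -/
noncomputable def excursionMeasure (x : E) : Measure E :=
  Measure.sum fun i : ℕ => ((law P x).restrict (noReturn x i)).map fun ω => ω i

theorem excursionMeasure_singleton (x y : E) :
    excursionMeasure P x {y} = ∑' i : ℕ, law P x (noReturn x i ∩ {ω | ω i = y}) := by
  rw [excursionMeasure, Measure.sum_apply _ (measurableSet_singleton _)]
  refine tsum_congr fun i => ?_
  rw [Measure.map_apply (measurable_pi_apply i) (measurableSet_singleton _),
    Measure.restrict_apply (measurable_pi_apply i (measurableSet_singleton _)), Set.inter_comm]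
  rfl

theorem IsRecurrent.accessible_of_excursionMeasure_ne_zero {P : Kernel E E} [IsMarkovKernel P]
    {x : E} (hx : IsRecurrent P x) {y : E} (h : excursionMeasure P x {y} ≠ 0) : Accessible P x y := by
  rw [excursionMeasure_singleton, Ne, ENNReal.tsum_eq_zero, not_forall] at h
  obtain ⟨i, hi⟩ := h
  have h1 : law P x {ω | ω i = y} ≠ 0 := fun h0 =>
    hi (measure_mono_null Set.inter_subset_right h0)
  rcases Nat.eq_zero_or_pos i with rfl | hi0
  · by_cases hxy : x = y
    · exact hxy ▸ hx.accessible_self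
    · refine absurd (measure_mono_null (fun ω hω => ?_) (law_coord_zero P x)) h1
      simp only [Set.mem_compl_iff, Set.mem_ofPred_eq]
      exact fun h => hxy (Eq.trans (Eq.symm h) hω)
  · exact ⟨i, hi0, pos_iff_ne_zero.2 h1⟩

variable [Countable E]

/-- The last-step form of the Markov property. -/
theorem setLIntegral_law_eq (x z : E) {k : ℕ} {B : Set (ℕ → E)}
    (hB : DependsOn (fun ω => ω ∈ B) (Set.Iic k)) :
    ∫⁻ ω in B, P (ω k) {z} ∂(law P x) = law P x (B ∩ {ω | ω (k + 1) = z}) := by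
  have hBm := measurableSet_of_dependsOn hB
  have hm : Measurable fun y => P y {z} := Measurable.of_discrete
  have h1 : ∫⁻ ω in B, P (ω k) {z} ∂(law P x) =
      ∑' y, P y {z} * law P x (B ∩ {ω | ω k = y}) := by
    rw [← lintegral_map (g := fun ω : ℕ → E => ω k) hm (measurable_pi_apply k),
      lintegral_countable']
    refine tsum_congr fun y => ?_
    rw [Measure.map_apply (measurable_pi_apply k) (measurableSet_singleton _),
      Measure.restrict_apply (measurable_pi_apply k (measurableSet_singleton _)), Set.inter_comm]
    rfl
  have h2 : B ∩ {ω | ω (k + 1) = z} =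
      ⋃ y, B ∩ {ω | ω k = y} ∩ shift k ⁻¹' {ω | ω 1 = z} := by
    ext ω
    simp [shift]
  rw [h1, h2, measure_iUnion]
  · refine tsum_congr fun y => ?_
    rw [law_inter_shift_preimage P x y _ (fun ω hω => hω.2) (measurableSet_coord_eq 1 z),
      law_coord_one, mul_comm]
    intro ω ω' h
    have h3 := hB h
    simp only at h3
    simp only [Set.mem_inter_iff, h3, Set.mem_ofPred_eq, h k (Set.mem_Iic.2 le_rfl)]
  · intro y y' hy
    refine Set.disjoint_left.2 fun ω h1 h2 => hy ?_
    exact Eq.trans (Eq.symm h1.1.2) h2.1.2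
  · exact fun y => (hBm.inter (measurableSet_coord_eq k y)).inter
      (measurable_shift k (measurableSet_coord_eq 1 z))

variable {P} {x : E}

theorem excursionMeasure_self (P : Kernel E E) [IsMarkovKernel P] (x : E) :
    excursionMeasure P x {x} = 1 := by
  rw [excursionMeasure_singleton, tsum_eq_single 0]
  · rw [← prob_compl_eq_zero_iff ((measurableSet_noReturn x 0).inter (measurableSet_coord_eq 0 x))]
    refine measure_mono_null (fun ω hω => ?_) (law_coord_zero P x)
    simp only [Set.mem_compl_iff, Set.mem_ofPred_eq]
    intro h
    exact hω ⟨fun j h1 h2 => by lia, h⟩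
  · intro i hi
    have : noReturn x i ∩ {ω : ℕ → E | ω i = x} = ∅ :=
      Set.eq_empty_iff_forall_notMem.2 fun ω hω => hω.1 i (Nat.one_le_iff_ne_zero.2 hi) le_rfl hω.2
    rw [this, measure_empty]

theorem IsRecurrent.tsum_law_firstReturn (hx : IsRecurrent P x) :
    ∑' i : ℕ, law P x (noReturn x i ∩ {ω | ω (i + 1) = x}) = 1 := by
  have h0 : ∀ (i : ℕ) (ω : ℕ → E), ω ∈ noReturn x i ∩ {ω | ω (i + 1) = x} ↔
      firstReturn x ω = i + 1 := by
    intro i ω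
    rw [firstReturn_eq_iff (Nat.le_add_left 1 i), and_comm]
    simp only [Nat.lt_succ_iff]
    rfl
  rw [← measure_iUnion]
  · have h1 : ∀ᵐ ω ∂(law P x), ω ∈ ⋃ i : ℕ, noReturn x i ∩ {ω | ω (i + 1) = x} := by
      filter_upwards [hx.ae_firstReturn_pos] with ω hω
      exact Set.mem_iUnion.2 ⟨firstReturn x ω - 1, (h0 _ ω).2 (by lia)⟩
    refine (mem_ae_iff_prob_eq_one (MeasurableSet.iUnion fun i => ?_)).1 h1
    exact (measurableSet_noReturn x i).inter (measurableSet_coord_eq _ _)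
  · intro i j hij
    refine Set.disjoint_left.2 fun ω h1 h2 => hij ?_
    have h3 := (h0 i ω).1 h1
    have h4 := (h0 j ω).1 h2
    lia
  · exact fun i => (measurableSet_noReturn x i).inter (measurableSet_coord_eq _ _)

/-- The excursion measure of a recurrent state is invariant: one step of the chain moves the
visits at times `0, …, T - 1` of an excursion of length `T` to the visits at times `1, …, T`, and
both at time `0` and at time `T` the chain is at `x`. -/
theorem IsRecurrent.invariant_excursionMeasure (hx : IsRecurrent P x) :
    P.Invariant (excursionMeasure P x) := by
  refine Measure.ext_of_singleton fun z => ?_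
  have h1 : ((excursionMeasure P x).bind P) {z} =
      ∑' i : ℕ, law P x (noReturn x i ∩ {ω | ω (i + 1) = z}) := by
    rw [Measure.bind_apply (measurableSet_singleton _) P.measurable.aemeasurable,
      excursionMeasure, lintegral_sum_measure]
    refine tsum_congr fun i => ?_
    rw [lintegral_map Measurable.of_discrete (measurable_pi_apply i),
      setLIntegral_law_eq P x z (dependsOn_noReturn x i)]
  rw [h1]
  by_cases hz : z = x
  · rw [hz, excursionMeasure_self, hx.tsum_law_firstReturn]
  · rw [excursionMeasure_singleton, tsum_eq_zero_add' (f := fun i : ℕ =>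
      law P x (noReturn x i ∩ {ω | ω i = z})) ENNReal.summable]
    have h2 : law P x (noReturn x 0 ∩ {ω | ω 0 = z}) = 0 := by
      refine measure_mono_null (fun ω hω => ?_) (law_coord_zero P x)
      simp only [Set.mem_compl_iff, Set.mem_ofPred_eq]
      exact fun h => hz (Eq.trans (Eq.symm hω.2) h)
    rw [h2, zero_add]
    refine tsum_congr fun i => congrArg _ (Set.ext fun ω => and_congr_left fun h => ?_)
    refine ⟨fun h1 j hj hji => ?_, fun h1 j hj hji => h1 j hj (by lia)⟩
    rcases Nat.le_succ_iff.1 hji with hji | rfl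
    · exact h1 j hj hji
    · rw [show ω (i + 1) = z from h]
      exact hz

theorem IsRecurrent.excursionMeasure_univ (hx : IsRecurrent P x) :
    excursionMeasure P x Set.univ = ∫⁻ ω, returnTime x ω ∂(law P x) := by
  have h1 : ∀ᵐ ω ∂(law P x), ∑' i : ℕ, (noReturn x i).indicator 1 ω = returnTime x ω := by
    filter_upwards [hx.ae_firstReturn_pos] with ω hω
    rw [returnTime_eq hω, tsum_eq_sum (s := Finset.range (firstReturn x ω))]
    · rw [Finset.sum_congr rfl fun i hi => Set.indicator_of_mem
        ((mem_noReturn_iff hω).2 (Finset.mem_range.1 hi)) _]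
      simp
    · intro i hi
      exact Set.indicator_of_notMem
        (fun h => hi (Finset.mem_range.2 ((mem_noReturn_iff hω).1 h))) _
  rw [← lintegral_congr_ae h1, lintegral_tsum fun i =>
    (measurable_one.indicator (measurableSet_noReturn x i)).aemeasurable, excursionMeasure,
    Measure.sum_apply _ MeasurableSet.univ]
  refine tsum_congr fun i => ?_
  rw [lintegral_indicator_one (measurableSet_noReturn x i),
    Measure.map_apply (measurable_pi_apply i) MeasurableSet.univ]
  simp

/-- The normalized excursion measure is a stationary distribution. -/
theorem IsPositiveRecurrentClass.exists_isStationaryOn {A : Set E}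
    (hA : IsPositiveRecurrentClass P A) : ∃ π : ProbabilityMeasure E, IsStationaryOn P A π := by
  obtain ⟨x, hxA⟩ := hA.1.1.1
  have hx := hA.2 x hxA
  set ν := excursionMeasure P x with hν
  have hfin : ν Set.univ ≠ ⊤ := by
    rw [hν, hx.1.excursionMeasure_univ]
    exact hx.2.ne
  have hne : ν Set.univ ≠ 0 := fun h => by
    have h1 := measure_mono_null (Set.subset_univ {x}) h
    rw [hν, excursionMeasure_self] at h1
    exact one_ne_zero h1
  have hprob : IsProbabilityMeasure ((ν Set.univ)⁻¹ • ν) :=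
    ⟨by rw [Measure.smul_apply, smul_eq_mul, ENNReal.inv_mul_cancel hne hfin]⟩
  have hAc : ν Aᶜ = 0 := by
    rw [← Set.biUnion_of_singleton Aᶜ, measure_biUnion_null_iff (Set.to_countable _)]
    intro y hy
    by_contra h
    exact hy (hA.1.2.1 x hxA y (hx.1.accessible_of_excursionMeasure_ne_zero h))
  refine ⟨⟨(ν Set.univ)⁻¹ • ν, hprob⟩, ?_, ?_⟩
  · change ((ν Set.univ)⁻¹ • ν).bind P = (ν Set.univ)⁻¹ • ν
    rw [Measure.bind_smul, hx.1.invariant_excursionMeasure.def]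
  · change ((ν Set.univ)⁻¹ • ν) A = 1
    refine (prob_compl_eq_zero_iff (Set.to_countable A).measurableSet).1 ?_
    change (ν Set.univ)⁻¹ * ν Aᶜ = 0
    rw [hAc, mul_zero]

/-- The chain started from an invariant distribution has this distribution at all times. -/
theorem bind_law_coord_eq {π : Measure E} (hπ : P.Invariant π) (k : ℕ) (y : E) :
    (π.bind (law P)) {ω | ω k = y} = π {y} := by
  have hm : ∀ C : Set (ℕ → E), MeasurableSet C → (π.bind (law P)) C = ∫⁻ x, law P x C ∂π :=
    fun C hC => Measure.bind_apply hC Measurable.of_discrete.aemeasurable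
  induction k generalizing y with
  | zero =>
    rw [hm _ (measurableSet_coord_eq 0 y)]
    have h : ∀ x, law P x {ω | ω 0 = y} = ({y} : Set E).indicator 1 x := fun x => by
      rw [← law_pathCylinder_zero P x fun _ => y]
      congr 1
      ext ω
      simp [pathCylinder]
    simp_rw [h]
    rw [lintegral_indicator_one (measurableSet_singleton y)]
  | succ k ih =>
    have h1 : (π.bind (law P)).map (fun ω => ω k) = π := Measure.ext_of_singleton fun y => by
      rw [Measure.map_apply (measurable_pi_apply k) (measurableSet_singleton _)]
      exact ih y
    have h2 : ∀ x, law P x {ω | ω (k + 1) = y} = ∫⁻ ω, P (ω k) {y} ∂(law P x) := fun x => by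
      have := setLIntegral_law_eq P x y (k := k) (B := Set.univ) (fun _ _ _ => rfl)
      rw [Measure.restrict_univ, Set.univ_inter] at this
      exact this.symm
    have hP : Measurable fun z => P z {y} := Measurable.of_discrete
    rw [hm _ (measurableSet_coord_eq _ y)]
    simp_rw [h2]
    rw [← Measure.lintegral_bind (f := fun ω : ℕ → E => P (ω k) {y})
      Measurable.of_discrete.aemeasurable (hP.comp (measurable_pi_apply k)).aemeasurable]
    have h3 := lintegral_map (μ := π.bind (law P)) hP (measurable_pi_apply k)
    rw [h1, ← Measure.bind_apply (measurableSet_singleton y) P.measurable.aemeasurable,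
      hπ.def] at h3
    exact h3.symm

/-- If the chain has the same visit frequencies from all states of `A`, then these are the masses
of any stationary distribution on `A`. -/
theorem IsStationaryOn.real_singleton_eq {A : Set E} {π : ProbabilityMeasure E}
    (hπ : IsStationaryOn P A π) {c : E → ℝ}
    (hc : ∀ a ∈ A, ∀ᵐ ω ∂(law P a), HasVisitFrequencies ω c) (y : E) :
    (π : Measure E).real {y} = c y := by
  -- the law of the chain with initial distribution `π`
  set Q := (π : Measure E).bind (law P) with hQ
  have hbind : ∀ C : Set (ℕ → E), MeasurableSet C → Q C = ∫⁻ x, law P x C ∂(π : Measure E) :=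
    fun C hC => Measure.bind_apply hC Measurable.of_discrete.aemeasurable
  have hQ1 : IsProbabilityMeasure Q := ⟨by simp [hbind _ MeasurableSet.univ]⟩
  have hcm := measurableSet_hasVisitFrequencies c
  have hae : ∀ᵐ ω ∂Q, HasVisitFrequencies ω c := by
    change Q {ω | HasVisitFrequencies ω c}ᶜ = 0
    rw [hbind _ hcm.compl, lintegral_eq_zero_iff Measurable.of_discrete]
    have hAae : ∀ᵐ a ∂(π : Measure E), a ∈ A :=
      (mem_ae_iff_prob_eq_one (Set.to_countable A).measurableSet).2 hπ.2
    filter_upwards [hAae] with a ha using hc a ha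
  set g : E → ℝ := Set.indicator {y} fun _ => (1 : ℝ) with hg
  have hgm : ∀ i : ℕ, Measurable fun ω : ℕ → E => g (ω i) := fun i =>
    (Measurable.of_discrete (f := g)).comp (measurable_pi_apply i)
  have hg0 : ∀ z, 0 ≤ g z := fun z => Set.indicator_nonneg (fun _ _ => zero_le_one) z
  have hg1 : ∀ z, g z ≤ 1 := fun z => Set.indicator_le_self' (fun _ _ => zero_le_one) z
  have hgint : ∀ i : ℕ, ∫ ω, g (ω i) ∂Q = (π : Measure E).real {y} := by
    intro i
    have h1 : (fun ω : ℕ → E => g (ω i)) = {ω : ℕ → E | ω i = y}.indicator 1 := by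
      ext ω
      by_cases h : ω i = y <;> simp [hg, h]
    rw [h1, integral_indicator_one (measurableSet_coord_eq i y), measureReal_def,
      bind_law_coord_eq hπ.1, measureReal_def]
  have hlim : Tendsto (fun M : ℕ => ∫ ω, (1 / (M : ℝ)) * ∑ i ∈ Finset.range M, g (ω i) ∂Q) atTop
      (𝓝 (∫ _, c y ∂Q)) := by
    refine tendsto_integral_of_dominated_convergence (fun _ => 1) (fun M => ?_)
      (integrable_const _) (fun M => ae_of_all _ fun ω => ?_) ?_
    · exact ((Finset.measurable_sum _ fun i _ => hgm i).const_mul _).aestronglyMeasurable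
    · rw [Real.norm_of_nonneg (mul_nonneg (by positivity) (Finset.sum_nonneg fun i _ => hg0 _)),
        one_div, inv_mul_eq_div]
      refine div_le_one_of_le₀ ?_ (Nat.cast_nonneg M)
      calc ∑ i ∈ Finset.range M, g (ω i) ≤ ∑ i ∈ Finset.range M, (1 : ℝ) :=
            Finset.sum_le_sum fun i _ => hg1 _
        _ = M := by simp
    · filter_upwards [hae] with ω hω using hω y
  have hconst : ∀ M : ℕ, 1 ≤ M → ∫ ω, (1 / (M : ℝ)) * ∑ i ∈ Finset.range M, g (ω i) ∂Q =
      (π : Measure E).real {y} := by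
    intro M hM
    have hM0 : (M : ℝ) ≠ 0 := by exact_mod_cast (by lia : M ≠ 0)
    rw [integral_const_mul, integral_finsetSum]
    · simp only [hgint, Finset.sum_const, Finset.card_range, nsmul_eq_mul]
      field_simp
    · intro i _
      refine (integrable_const (1 : ℝ)).mono' (hgm i).aestronglyMeasurable (ae_of_all _ fun ω => ?_)
      rw [Real.norm_of_nonneg (hg0 _)]
      exact hg1 _
  have hlim' : Tendsto (fun M : ℕ => ∫ ω, (1 / (M : ℝ)) * ∑ i ∈ Finset.range M, g (ω i) ∂Q) atTop
      (𝓝 ((π : Measure E).real {y})) := by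
    refine tendsto_const_nhds.congr' ?_
    filter_upwards [eventually_ge_atTop 1] with M hM using (hconst M hM).symm
  simpa using tendsto_nhds_unique hlim' hlim

/-- From every state of a positive recurrent class, the visit frequencies are almost surely the
masses of a stationary distribution, whichever it is. -/
theorem IsStationaryOn.ae_hasVisitFrequencies {A : Set E} {π : ProbabilityMeasure E}
    (hπ : IsStationaryOn P A π) (hA : IsPositiveRecurrentClass P A) :
    ∀ a ∈ A, ∀ᵐ ω ∂(law P a), HasVisitFrequencies ω fun y => (π : Measure E).real {y} := by
  obtain ⟨x, hxA⟩ := hA.1.1.1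
  obtain ⟨c, hc⟩ := (hA.2 x hxA).exists_hasVisitFrequencies
  have hcA : ∀ a ∈ A, ∀ᵐ ω ∂(law P a), HasVisitFrequencies ω c := by
    intro a ha
    obtain ⟨k, -, hk⟩ := hA.1.accessible hxA ha
    refine ae_law_of_ae_shift P hk (measurableSet_hasVisitFrequencies c) ?_
    filter_upwards [hc] with ω hω using (hasVisitFrequencies_shift_iff k ω c).2 hω
  have h : (fun y => (π : Measure E).real {y}) = c := funext (hπ.real_singleton_eq hcA)
  rwa [h]

theorem IsPositiveRecurrentClass.existsUnique_isStationaryOn {A : Set E}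
    (hA : IsPositiveRecurrentClass P A) :
    ∃! π : ProbabilityMeasure E, IsStationaryOn P A π := by
  obtain ⟨π, hπ⟩ := hA.exists_isStationaryOn
  obtain ⟨x, hx⟩ := hA.1.1.1
  refine ⟨π, hπ, fun π' hπ' => ?_⟩
  obtain ⟨ω, h1, h2⟩ := ((hπ'.ae_hasVisitFrequencies hA x hx).and
    (hπ.ae_hasVisitFrequencies hA x hx)).exists
  have h : (π' : Measure E) = π := Measure.ext_of_singleton fun y =>
    (measureReal_eq_measureReal_iff (measure_ne_top _ _) (measure_ne_top _ _)).1
      (congrFun (h1.eq h2) y)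
  exact Subtype.ext h

end MarkovChain

/-- On a countable space, convergence of the visit frequencies to the masses of a probability
measure implies weak convergence of the empirical measures: by Fatou's lemma the masses of open
sets are lower semicontinuous in the limit. -/
theorem MarkovChain.HasVisitFrequencies.tendsto_empiricalMeasure {E : Type*} [MeasurableSpace E]
    [Countable E] [TopologicalSpace E] [TopologicalSpace.PseudoMetrizableSpace E] [BorelSpace E]
    [MeasurableSingletonClass E] {ω : ℕ → E} {π : ProbabilityMeasure E}
    (h : HasVisitFrequencies ω fun y => (π : Measure E).real {y}) :
    Tendsto (empiricalMeasure ω) atTop (𝓝 π.toFiniteMeasure) := by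
  have hE : ∀ (M : ℕ) (s : Set E), MeasurableSet s → (empiricalMeasure ω M : Measure E) s =
      (M : ENNReal)⁻¹ * ∑ i ∈ Finset.range M, s.indicator 1 (ω i) := by
    intro M s hs
    by_cases hM : M = 0
    · simp [hM, empiricalMeasure]
    rw [empiricalMeasure, FiniteMeasure.toMeasure_smul, FiniteMeasure.toMeasure_sum,
      Measure.smul_apply, Measure.finsetSum_apply, ENNReal.smul_def, smul_eq_mul,
      ENNReal.coe_inv (by exact_mod_cast hM), ENNReal.coe_natCast]
    congr 1
    exact Finset.sum_congr rfl fun i _ => Measure.dirac_apply' _ hs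
  have hprob : ∀ M : ℕ, IsProbabilityMeasure (empiricalMeasure ω (M + 1) : Measure E) := fun M =>
    ⟨by
      rw [hE _ _ MeasurableSet.univ]
      simp only [Set.indicator_univ, Pi.one_apply, Finset.sum_const, Finset.card_range,
        nsmul_eq_mul, mul_one]
      exact ENNReal.inv_mul_cancel (by simp) (by simp)⟩
  let μs : ℕ → ProbabilityMeasure E := fun M => ⟨empiricalMeasure ω (M + 1), hprob M⟩
  have hsing : ∀ y, Tendsto (fun M => (μs M : Measure E) {y}) atTop (𝓝 ((π : Measure E) {y})) := by
    intro y
    have h1 := ENNReal.tendsto_ofReal ((tendsto_add_atTop_iff_nat 1).2 (h y))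
    rw [ofReal_measureReal] at h1
    refine h1.congr fun M => ?_
    change _ = (empiricalMeasure ω (M + 1) : Measure E) {y}
    rw [hE _ _ (measurableSet_singleton y), ENNReal.ofReal_mul (by positivity), one_div,
      ENNReal.ofReal_inv_of_pos (by positivity), ENNReal.ofReal_natCast,
      ENNReal.ofReal_sum_of_nonneg fun i _ => Set.indicator_nonneg (fun _ _ => zero_le_one) _]
    congr 1
    refine Finset.sum_congr rfl fun i _ => ?_
    by_cases hi : ω i = y <;> simp [hi]
  have hlim : Tendsto μs atTop (𝓝 π) := by
    refine tendsto_of_forall_isOpen_le_liminf' fun G hG => ?_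
    have hm : ∀ ν : Measure E, ν G = ∫⁻ y, G.indicator (fun x => ν {x}) y ∂Measure.count :=
      fun ν => by rw [lintegral_count, Measure.tsum_indicator_apply_singleton _ _ hG.measurableSet]
    simp_rw [hm]
    refine le_trans (lintegral_mono fun y => ?_)
      (lintegral_liminf_le fun M => Measurable.of_discrete)
    by_cases hy : y ∈ G
    · simp only [Set.indicator_of_mem hy]
      exact (hsing y).liminf_eq.ge
    · simp [hy]
  rw [ProbabilityMeasure.tendsto_nhds_iff_toFiniteMeasure_tendsto_nhds] at hlim
  exact (tendsto_add_atTop_iff_nat 1).1 hlim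

/-! ### Long-run behaviour of paths -/

namespace MarkovChain

variable {E : Type*} [MeasurableSpace E] [MeasurableSingletonClass E] [Countable E]
  {P : Kernel E E} [IsMarkovKernel P]

/-- A chain that leaves the transient states is eventually absorbed by a recurrent class, all of
whose states it visits; if the class is positive recurrent, its stationary distribution gives the
visit frequencies. -/
theorem LeavesTransient.ae_exists_isRecurrentClass (hP : LeavesTransient P) (x₀ : E) :
    ∀ᵐ ω ∂(law P x₀), ∃ A : Set E, IsRecurrentClass P A ∧
      (∃ m : ℕ, {x | ∃ i ≥ m, ω i = x} = A) ∧
      (IsPositiveRecurrentClass P A → ∀ π : ProbabilityMeasure E, IsStationaryOn P A π →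
        HasVisitFrequencies ω fun y => (π : Measure E).real {y}) := by
  have h1 : ∀ y ∈ {y | IsRecurrent P y}, ∀ᵐ ω ∂(law P y), ∃ A : Set E, IsRecurrentClass P A ∧
      Set.range ω = A ∧ (IsPositiveRecurrentClass P A → ∀ π : ProbabilityMeasure E,
        IsStationaryOn P A π → HasVisitFrequencies ω fun y => (π : Measure E).real {y}) := by
    intro y hy
    have hy : IsRecurrent P y := hy
    by_cases hA : IsPositiveRecurrentClass P {z | Accessible P y z}
    · obtain ⟨π, hπ, huniq⟩ := hA.existsUnique_isStationaryOn
      filter_upwards [hy.ae_range_eq, hπ.ae_hasVisitFrequencies hA y hy.accessible_self] with ω h2 h3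
      refine ⟨_, hy.isRecurrentClass_accessible, h2, fun _ π' hπ' => ?_⟩
      rw [huniq π' hπ']
      exact h3
    · filter_upwards [hy.ae_range_eq] with ω h2
      exact ⟨_, hy.isRecurrentClass_accessible, h2, fun h => absurd h hA⟩
  have h2 : ∀ᵐ ω ∂(law P x₀), ∀ k : ℕ, ω k ∈ {y | IsRecurrent P y} →
      ∃ A : Set E, IsRecurrentClass P A ∧ Set.range (shift k ω) = A ∧
        (IsPositiveRecurrentClass P A → ∀ π : ProbabilityMeasure E, IsStationaryOn P A π →
          HasVisitFrequencies (shift k ω) fun y => (π : Measure E).real {y}) :=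
    ae_all_iff.2 fun k => ae_shift_of_forall_mem P x₀ k h1
  filter_upwards [hP x₀, h2] with ω ⟨k, hk⟩ h
  obtain ⟨A, hA, hr, hfreq⟩ := h k (not_not.1 hk)
  refine ⟨A, hA, ⟨k, ?_⟩, fun hpos π hπ => (hasVisitFrequencies_shift_iff k ω _).1 (hfreq hpos π hπ)⟩
  rw [← hr]
  ext y
  simp only [Set.mem_ofPred_eq, Set.mem_range, shift]
  constructor
  · rintro ⟨i, hi, rfl⟩
    exact ⟨i - k, by rw [Nat.add_sub_cancel' hi]⟩
  · rintro ⟨i, rfl⟩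
    exact ⟨k + i, Nat.le_add_right k i, rfl⟩

/-- Once the chain is in a positive recurrent class, its visit frequencies are the masses of the
stationary distribution. -/
theorem IsStationaryOn.ae_hasVisitFrequencies_of_mem {A : Set E} {π : ProbabilityMeasure E}
    (hπ : IsStationaryOn P A π) (hA : IsPositiveRecurrentClass P A) (x₀ : E) (j : ℕ) :
    ∀ᵐ ω ∂(law P x₀), ω j ∈ A → HasVisitFrequencies ω fun y => (π : Measure E).real {y} := by
  filter_upwards [ae_shift_of_forall_mem P x₀ j (hπ.ae_hasVisitFrequencies hA)] with ω h hj
  exact (hasVisitFrequencies_shift_iff j ω _).1 (h hj)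

/-! ### Finite state spaces -/

/-- A transient state `y` is almost surely visited only finitely often. If `u` is the probability
of infinitely many visits from `y` itself and `r < 1` the return probability, then `u = r * u`. -/
theorem ae_not_frequently_of_not_isRecurrent {y : E} (hy : ¬ IsRecurrent P y) (x : E) :
    ∀ᵐ ω ∂(law P x), ¬ ∃ᶠ k in atTop, ω k = y := by
  set Q : Set (ℕ → E) := {ω | ∃ᶠ k in atTop, ω k = y} with hQ
  have hQm : MeasurableSet Q := measurableSet_frequently_coord_eq y
  have h1 := law_inter_nextExcursion_preimage P y y (determinedByReturn_univ y) hQm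
  have h2 : {ω | 0 < firstReturn y ω} ∩ Set.univ ∩ nextExcursion y ⁻¹' Q = Q := by
    ext ω
    simp only [Set.inter_univ, Set.mem_inter_iff, Set.mem_ofPred_eq, Set.mem_preimage, hQ,
      nextExcursion]
    rw [frequently_shift_iff (firstReturn y ω) ω (· = y), and_iff_right_iff_imp]
    exact fun h => firstReturn_pos_iff.2 (frequently_atTop.1 h 1)
  rw [h2, Set.inter_univ] at h1
  have hQ0 : law P y Q = 0 := by
    by_contra hne
    have h3 : law P y Q * law P y {ω | 0 < firstReturn y ω} = law P y Q * 1 := by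
      rw [mul_comm, ← h1, mul_one]
    have h4 := (ENNReal.mul_right_inj hne (measure_ne_top _ _)).1 h3
    have hm : MeasurableSet {ω | 0 < firstReturn y ω} :=
      measurable_firstReturn y (measurableSet_Ioi (a := 0))
    refine hy ?_
    filter_upwards [(mem_ae_iff_prob_eq_one hm).2 h4] with ω hω using firstReturn_pos_iff.1 hω
  have h5 : ∀ a ∈ ({y} : Set E), ∀ᵐ ω ∂(law P a), ω ∉ Q := by
    rintro _ rfl
    exact measure_eq_zero_iff_ae_notMem.1 hQ0
  filter_upwards [ae_all_iff.2 fun k => ae_shift_of_forall_mem P x k h5] with ω h hω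
  obtain ⟨k, hk⟩ := hω.exists
  exact h k hk ((frequently_shift_iff k ω (· = y)).2 hω)

theorem leavesTransient_of_finite [Finite E] (P : Kernel E E) [IsMarkovKernel P] :
    LeavesTransient P := by
  intro x
  have h1 : ∀ᵐ ω ∂(law P x), ∀ y, ¬ IsRecurrent P y → ¬ ∃ᶠ k in atTop, ω k = y := by
    refine ae_all_iff.2 fun y => ?_
    by_cases hy : IsRecurrent P y
    · exact ae_of_all _ fun ω h => absurd hy h
    · filter_upwards [ae_not_frequently_of_not_isRecurrent hy x] with ω hω _ using hω
  filter_upwards [h1] with ω h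
  by_contra! hn
  have h2 : ∀ y, ∀ᶠ k in atTop, ω k ≠ y := by
    intro y
    by_cases hy : IsRecurrent P y
    · exact Eventually.of_forall fun k hk => hn k (hk ▸ hy)
    · exact not_frequently.1 (h y hy)
  obtain ⟨k, hk⟩ := (eventually_all.2 h2).exists
  exact hk _ rfl

/-- On a finite state space, recurrent classes are positive recurrent. The excursion measure `ν`
from `x` is invariant with `ν {x} = 1`, so `ν {y}` times the probability to go from `y` to `x` in
`k` steps is at most `1`; hence all masses of `ν` are finite, and so is its total mass, which is the
expected return time. -/
theorem IsRecurrentClass.isPositiveRecurrentClass_of_finite [Finite E] {A : Set E}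
    (hA : IsRecurrentClass P A) : IsPositiveRecurrentClass P A := by
  refine ⟨hA, fun x hxA => ?_⟩
  have hx := hA.2.2 x hxA
  refine ⟨hx, ?_⟩
  rw [← hx.excursionMeasure_univ, ← Set.biUnion_of_singleton Set.univ]
  refine measure_biUnion_lt_top Set.finite_univ fun y _ => ?_
  by_cases hy : excursionMeasure P x {y} = 0
  · rw [hy]
    exact ENNReal.zero_lt_top
  have hyA := hA.2.1 x hxA y (hx.accessible_of_excursionMeasure_ne_zero hy)
  obtain ⟨k, -, hk⟩ := hA.accessible hyA hxA
  have h1 := bind_law_coord_eq hx.invariant_excursionMeasure k x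
  rw [excursionMeasure_self, Measure.bind_apply (measurableSet_coord_eq k x)
    Measurable.of_discrete.aemeasurable, lintegral_countable'] at h1
  have h2 : law P y {ω | ω k = x} * excursionMeasure P x {y} ≤ 1 := h1 ▸ ENNReal.le_tsum y
  refine lt_top_iff_ne_top.2 fun h => ?_
  rw [h, ENNReal.mul_top hk.ne'] at h2
  exact absurd h2 (by simp)

end MarkovChain

/-! ### The random iteration algorithm -/

namespace DIFS

variable {n N : ℕ} {δ : ℝ} {D : DIFS n N δ} {Ω : Type*} [MeasurableSpace Ω] {μ : Measure Ω}
  {x₀ : D.S} {I : ℕ → Ω → Fin N} {X : ℕ → Ω → D.S}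

theorem IsRIA.measurable (hX : D.IsRIA μ x₀ I X) (k : ℕ) : Measurable (X k) := by
  induction k with
  | zero =>
    rw [funext hX.start]
    exact measurable_const
  | succ k ih =>
    rw [funext (hX.step k)]
    exact (Measurable.of_discrete (f := fun q : Fin N × D.S => D.w q.1 q.2)).comp
      ((hX.measurable_index k).prodMk ih)

theorem IsRIA.measurable_orbit (hX : D.IsRIA μ x₀ I X) : Measurable fun ω k => X k ω :=
  measurable_pi_lambda _ hX.measurable

/-- The orbit generated by the random iteration algorithm is a realization of the chain. -/
theorem IsRIA.map_orbit_eq_law [IsProbabilityMeasure μ] (hX : D.IsRIA μ x₀ I X) :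
    μ.map (fun ω k => X k ω) = MarkovChain.law D.kernel x₀ := by
  have : IsProbabilityMeasure (μ.map fun ω k => X k ω) :=
    Measure.isProbabilityMeasure_map hX.measurable_orbit.aemeasurable
  refine MarkovChain.eq_law_of_pathCylinder_succ D.kernel ?_ fun y k => ?_
  · rw [ae_map_iff hX.measurable_orbit.aemeasurable (MarkovChain.measurableSet_coord_eq 0 x₀)]
    exact ae_of_all _ hX.start
  have hm : ∀ k, MeasurableSet {ω | ∀ j ≤ k, X j ω = y j} := fun k =>
    hX.measurable_orbit (MarkovChain.measurableSet_pathCylinder y k)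
  rw [Measure.map_apply hX.measurable_orbit (MarkovChain.measurableSet_pathCylinder y _),
    Measure.map_apply hX.measurable_orbit (MarkovChain.measurableSet_pathCylinder y _)]
  change μ {ω | ∀ j ≤ k + 1, X j ω = y j} = μ {ω | ∀ j ≤ k, X j ω = y j} *
    (∑ i, ENNReal.ofReal (D.p i (y k)) • Measure.dirac (D.w i (y k))) {y (k + 1)}
  let B : Fin N → Set Ω := fun i =>
    {ω | D.w i (y k) = y (k + 1) ∧ (∀ j ≤ k, X j ω = y j) ∧ I (k + 1) ω = i}
  have hB : {ω | ∀ j ≤ k + 1, X j ω = y j} = ⋃ i, B i := by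
    ext ω
    simp only [Set.mem_ofPred_eq, Set.mem_iUnion, B]
    constructor
    · intro h
      refine ⟨I (k + 1) ω, ?_, fun j hj => h j (by lia), rfl⟩
      rw [← h (k + 1) le_rfl, hX.step, h k (by lia)]
    · rintro ⟨i, h1, h2, rfl⟩ j hj
      rcases Nat.le_succ_iff.1 hj with hj | rfl
      · exact h2 j hj
      · rw [hX.step, h2 k le_rfl, h1]
  have hBm : ∀ i, MeasurableSet (B i) := fun i =>
    (MeasurableSet.const _).inter ((hm k).inter
      (hX.measurable_index k (measurableSet_singleton i)))
  rw [hB, measure_iUnion _ hBm, tsum_fintype, Measure.finsetSum_apply, Finset.mul_sum]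
  · refine Finset.sum_congr rfl fun i _ => ?_
    rw [Measure.smul_apply, Measure.dirac_apply' _ (measurableSet_singleton _), smul_eq_mul]
    by_cases hi : D.w i (y k) = y (k + 1)
    · have := hX.draw k y i
      simp only [B, hi, true_and, this, Set.mem_singleton_iff, Set.indicator_of_mem, Pi.one_apply,
        mul_one]
      rw [mul_comm]
    · simp [B, hi]
  · intro i j hij
    exact Set.disjoint_left.2 fun ω h1 h2 => hij (h1.2.2.symm.trans h2.2.2)

end DIFS

theorem mainTheorem10 {n N : ℕ} {δ : ℝ} (hδ : 0 < δ) (D : DIFS n N δ)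
    (hD : MarkovChain.LeavesTransient D.kernel ∨ D.S.Finite)
    {Ω : Type*} [MeasurableSpace Ω] (μ : Measure Ω) [IsProbabilityMeasure μ]
    (x₀ : D.S) (I : ℕ → Ω → Fin N) (X : ℕ → Ω → D.S) (hX : D.IsRIA μ x₀ I X) :
    -- almost surely, some tail of the orbit is exactly one recurrent class, and if that class is
    -- positive recurrent, the empirical measures converge weakly to its stationary distribution
    (∀ᵐ ω ∂μ, ∃ A : Set D.S, MarkovChain.IsRecurrentClass D.kernel A ∧
      (∃ m : ℕ, {x | ∃ i ≥ m, X i ω = x} = A) ∧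
      (MarkovChain.IsPositiveRecurrentClass D.kernel A →
        ∀ π : ProbabilityMeasure D.S, MarkovChain.IsStationaryOn D.kernel A π →
          Tendsto (fun M : ℕ => empiricalMeasure (fun i => X i ω) M) atTop
            (𝓝 π.toFiniteMeasure))) ∧
    -- a positive recurrent class has a unique stationary distribution, which is the limit of the
    -- empirical measures and of the visit frequencies once the orbit enters the class
    (∀ A : Set D.S, MarkovChain.IsPositiveRecurrentClass D.kernel A →
      (∃! π : ProbabilityMeasure D.S, MarkovChain.IsStationaryOn D.kernel A π) ∧
      ∀ π : ProbabilityMeasure D.S, MarkovChain.IsStationaryOn D.kernel A π → ∀ j : ℕ,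
        (μ {ω | X j ω ∈ A} = 1 →
          ∀ᵐ ω ∂μ, ∀ y : D.S,
            Tendsto (fun M : ℕ => (1 / (M : ℝ)) *
                ∑ i ∈ Finset.range M, Set.indicator {y} (fun _ => (1 : ℝ)) (X i ω))
              atTop (𝓝 ((π : Measure D.S).real {y}))) ∧
        (0 < μ {ω | X j ω ∈ A} →
          (∀ᵐ ω ∂(ProbabilityTheory.cond μ {ω | X j ω ∈ A}),
            Tendsto (fun M : ℕ => empiricalMeasure (fun i => X i ω) M) atTop
              (𝓝 π.toFiniteMeasure)) ∧
          ∀ y : D.S, ∀ᵐ ω ∂(ProbabilityTheory.cond μ {ω | X j ω ∈ A}),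
            Tendsto (fun M : ℕ => (1 / (M : ℝ)) *
                ∑ i ∈ Finset.range M, Set.indicator {y} (fun _ => (1 : ℝ)) (X i ω))
              atTop (𝓝 ((π : Measure D.S).real {y})))) ∧
    -- for a finite state space the assumptions hold automatically
    (D.S.Finite → MarkovChain.LeavesTransient D.kernel ∧
      ∀ A : Set D.S, MarkovChain.IsRecurrentClass D.kernel A →
        MarkovChain.IsPositiveRecurrentClass D.kernel A) := by
  have transfer : ∀ R : (ℕ → D.S) → Prop, (∀ᵐ ω ∂(MarkovChain.law D.kernel x₀), R ω) →
      ∀ᵐ ω ∂μ, R fun k => X k ω := fun R hR => by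
    rw [← hX.map_orbit_eq_law] at hR
    exact ae_of_ae_map hX.measurable_orbit.aemeasurable hR
  have hfin : D.S.Finite → MarkovChain.LeavesTransient D.kernel := fun h => by
    have := h.to_subtype
    exact MarkovChain.leavesTransient_of_finite D.kernel
  have hleaves : MarkovChain.LeavesTransient D.kernel := hD.elim id hfin
  refine ⟨?_, fun A hA => ⟨hA.existsUnique_isStationaryOn, fun π hπ j => ?_⟩,
    fun h => ⟨hfin h, fun A hA => ?_⟩⟩
  · filter_upwards [transfer _ (hleaves.ae_exists_isRecurrentClass x₀)] with ω h
    obtain ⟨A, hA, hm, hfreq⟩ := h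
    exact ⟨A, hA, hm, fun hpos π hπ => (hfreq hpos π hπ).tendsto_empiricalMeasure⟩
  · have hae := transfer _ (hπ.ae_hasVisitFrequencies_of_mem hA x₀ j)
    have hAm : MeasurableSet {ω | X j ω ∈ A} := hX.measurable j (Set.to_countable A).measurableSet
    have hcond : ∀ᵐ ω ∂(ProbabilityTheory.cond μ {ω | X j ω ∈ A}),
        MarkovChain.HasVisitFrequencies (fun k => X k ω) fun y => (π : Measure D.S).real {y} := by
      filter_upwards [cond_absolutelyContinuous.ae_le hae, ae_cond_mem hAm] with ω h1 h2
      exact h1 h2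
    refine ⟨fun h => ?_, fun _ => ⟨?_, fun y => ?_⟩⟩
    · filter_upwards [hae, (mem_ae_iff_prob_eq_one hAm).2 h] with ω h1 h2 using h1 h2
    · filter_upwards [hcond] with ω hω using hω.tendsto_empiricalMeasure
    · filter_upwards [hcond] with ω hω using hω y
  · have := h.to_subtype
    exact hA.isPositiveRecurrentClass_of_finite
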